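/- Let $n\ge 0$ and $k\ge 1$ be integers and let $m_1,\dots,m_k\ge 2$ be integers such that neither ($n=0$ and $k=1$) nor ($n=0$, $k=2$ and $m_1=m_2=2$) holds. Let $G=F_{2n}*\mathbb{Z}_{m_1}*\cdots*\mathbb{Z}_{m_k}$, where $F_{2n}$ is the free group of rank $2n$ and $\mathbb{Z}_{m}=\mathbb{Z}/m\mathbb{Z}$, and let $$\widehat G=\langle e_1,\dots,e_k,h_1,\dots,h_{2n},z \mid e_1^{m_1}=\cdots=e_k^{m_k}=z,\ [h_1,z]=\cdots=[h_{2n},z]=1\rangle .$$ Then $\widehat G$ is a central extension of $G$ by $\mathbb{Z}$: the element $z$ is central and of infinite order, and there is a surjective homomorphism $\widehat G\to G$ with kernel $\langle z\rangle$. Moreover $\widehat G$ admits a countably infinite family of isolated left orders, no one of which is an automorphic image of another. Here a left order on a group $\Gamma$ is a strict total order $<$ such that $g_1<g_2$ implies $gg_1<gg_2$ for all $g,g_1,g_2\in\Gamma$. The set $LO(\Gamma)$ of left orders is topologized as a subspace of $\{\pm1\}^{\Gamma\setminus\{1\}}$ with the product topology, where $<$ corresponds to the function with value $+1$ at $g$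 if and only if $1<g$. A left order is isolated if it is an isolated point of $LO(\Gamma)$. For an automorphism $\phi$ of $\Gamma$, the automorphic image $<_\phi$ of $<$ is defined by $g_1<_\phi g_2$ if and only if $\phi(g_1)<\phi(g_2)$. -/

import Mathlib

/-- A left order on a group `Γ`: a strict total order invariant under left multiplication. -/
structure LeftOrder (Γ : Type*) [Group Γ] where
  lt : Γ → Γ → Prop
  strictTotal : IsStrictTotalOrder Γ lt
  mul_left : ∀ g g₁ g₂ : Γ, lt g₁ g₂ → lt (g * g₁) (g * g₂)

namespace LeftOrder

variable {Γ : Type*} [Group Γ]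

open Classical in
/-- The sign function of a left order on the nontrivial elements of the group: the value is
`true` (standing for `+1`) if `1 < g`, and `false` (standing for `-1`) otherwise. -/
noncomputable def sign (L : LeftOrder Γ) : {g : Γ // g ≠ 1} → Bool :=
  fun g => decide (L.lt 1 g.1)

/-- The space of left orders carries the topology of a subspace of `{±1} ^ (Γ ∖ {1})`
with the product topology, via the sign function. -/
noncomputable instance : TopologicalSpace (LeftOrder Γ) :=
  TopologicalSpace.induced sign inferInstance

/-- A left order is isolated if it is an isolated point of the space of left orders. -/
def IsIsolated (L : LeftOrder Γ) : Prop :=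
  IsOpen ({L} : Set (LeftOrder Γ))

/-- The automorphic image `<_φ` of a left order `<`: `g₁ <_φ g₂` iff `φ g₁ < φ g₂`. -/
def autImage (L : LeftOrder Γ) (φ : Γ ≃* Γ) : LeftOrder Γ where
  lt g₁ g₂ := L.lt (φ g₁) (φ g₂)
  strictTotal :=
    { trichotomous := fun a b h₁ h₂ => φ.injective (L.strictTotal.trichotomous _ _ h₁ h₂)
      irrefl := fun a => L.strictTotal.irrefl (φ a)
      trans := fun a b c => L.strictTotal.trans (φ a) (φ b) (φ c) }
  mul_left g g₁ g₂ h := by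
    rw [map_mul, map_mul]
    exact L.mul_left _ _ _ h

end LeftOrder

/-- The free product `F_{2n} * ℤ/m₁ * ⋯ * ℤ/m_k`. -/
abbrev FreeProdCyclic (n k : ℕ) (m : Fin k → ℕ) : Type :=
  Monoid.Coprod (FreeGroup (Fin (2 * n)))
    (Monoid.CoprodI fun i : Fin k => Multiplicative (ZMod (m i)))

namespace ExtGroup

/-- The generators `e₁, …, e_k`, `h₁, …, h_{2n}`, `z`. -/
inductive Gen (n k : ℕ) : Type
  | e : Fin k → Gen n k
  | h : Fin (2 * n) → Gen n k
  | z : Gen n k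

/-- The relators `eᵢ ^ mᵢ * z⁻¹` and `[hⱼ, z] = hⱼ * z * hⱼ⁻¹ * z⁻¹`. -/
def rels (n k : ℕ) (m : Fin k → ℕ) : Set (FreeGroup (Gen n k)) :=
  Set.range (fun i : Fin k =>
      FreeGroup.of (Gen.e i) ^ m i * (FreeGroup.of (Gen.z : Gen n k))⁻¹) ∪
    Set.range (fun j : Fin (2 * n) =>
      FreeGroup.of (Gen.h j : Gen n k) * FreeGroup.of (Gen.z : Gen n k) *
        (FreeGroup.of (Gen.h j : Gen n k))⁻¹ * (FreeGroup.of (Gen.z : Gen n k))⁻¹)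

end ExtGroup

/-- The group
`⟨e₁, …, e_k, h₁, …, h_{2n}, z ∣ e₁ ^ m₁ = ⋯ = e_k ^ m_k = z, [h₁, z] = ⋯ = [h_{2n}, z] = 1⟩`. -/
abbrev ExtGroup (n k : ℕ) (m : Fin k → ℕ) : Type :=
  PresentedGroup (ExtGroup.rels n k m)

/-- The element `z` of the group. -/
def ExtGroup.zElt (n k : ℕ) (m : Fin k → ℕ) : ExtGroup n k m :=
  PresentedGroup.of ExtGroup.Gen.z

/-!
The generators act on the line by lifts of circle homeomorphisms playing ping-pong with respect to a
partition of the circle into blocks: one for each `eᵢ`, four for each pair of generators `hⱼ`, and a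
cusp block which no letter of a normal form attracts or repels. Normal forms then determine the
position of every translate of a base cut point, so the action has a free orbit, and the resulting
left order is pinned down by finitely many inequalities between the elements carrying the base point
to the cut points; hence it is isolated.

Let `deg` be the homomorphism with `deg z = M = m₁ ⋯ m_k`, and let `c` generate the stabilizer of
the cusp block. The twists `g ↦ g z ^ (r deg g)` are injective with image of index `1 + rM`. For
`r = t deg c`, the powers of `c` represent the cosets of the image, and they squeeze additional cut
points into the cusp block; so the order pulled back along the twist is again isolated.

An automorphism relating two of these orders matches their greatest negative elements, whose twists
are the powers of `c` with exponents the two indices. The supremum of `|f|` over the homogeneous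
quasimorphisms `f` of bounded defect that vanish at `z` is invariant under automorphisms and twists,
and is positive and finite at `c`; so the two indices agree.
-/

/-- The homomorphism from `ℤ/d` that sends the generator to an element of order dividing `d`. -/
def zmodPowersHom {Q : Type*} [Group Q] {d : ℕ} (x : Q) (hx : x ^ d = 1) :
    Multiplicative (ZMod d) →* Q :=
  AddMonoidHom.toMultiplicativeLeft
    (ZMod.lift d ⟨zmultiplesHom _ (Additive.ofMul x), by simp [← ofMul_pow, hx]⟩)

theorem zmodPowersHom_ofAdd_one {Q : Type*} [Group Q] {d : ℕ} (x : Q) (hx : x ^ d = 1) :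
    zmodPowersHom x hx (Multiplicative.ofAdd 1) = x := by
  have h := ZMod.lift_coe d
    ⟨zmultiplesHom _ (Additive.ofMul x), by simp [← ofMul_pow, hx]⟩ (1 : ℤ)
  rw [Int.cast_one] at h
  simp [zmodPowersHom, h]

namespace ExtGroup

variable {n k : ℕ} {m : Fin k → ℕ}

/-- The generator `eᵢ`. -/
def eElt (n : ℕ) (m : Fin k → ℕ) (i : Fin k) : ExtGroup n k m := PresentedGroup.of (Gen.e i)

/-- The generator `hⱼ`. -/
def hElt (m : Fin k → ℕ) (j : Fin (2 * n)) : ExtGroup n k m := PresentedGroup.of (Gen.h j)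

theorem eElt_pow (i : Fin k) : eElt n m i ^ m i = zElt n k m := by
  have h := PresentedGroup.one_of_mem (rels := rels n k m) (Or.inl ⟨i, rfl⟩)
  rwa [map_mul, map_inv, map_pow, mul_inv_eq_one] at h

theorem hElt_commute_zElt (j : Fin (2 * n)) : Commute (hElt m j) (zElt n k m) := by
  have h := PresentedGroup.one_of_mem (rels := rels n k m) (Or.inr ⟨j, rfl⟩)
  rwa [map_mul, map_inv, mul_inv_eq_one, map_mul, map_inv, mul_inv_eq_iff_eq_mul, map_mul] at h

theorem closure_generators_eq_top :
    Subgroup.closure (insert (zElt n k m) (Set.range (eElt n m) ∪ Set.range (hElt m))) = ⊤ := by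
  rw [eq_top_iff, ← PresentedGroup.closure_range_of, Subgroup.closure_le]
  rintro _ ⟨i | j | _, rfl⟩ <;> apply Subgroup.subset_closure
  exacts [Or.inr (Or.inl ⟨i, rfl⟩), Or.inr (Or.inr ⟨j, rfl⟩), Or.inl rfl]

theorem hom_ext {Q : Type*} [Group Q] {f g : ExtGroup n k m →* Q}
    (hz : f (zElt n k m) = g (zElt n k m)) (he : ∀ i, f (eElt n m i) = g (eElt n m i))
    (hh : ∀ j, f (hElt m j) = g (hElt m j)) : f = g := by
  refine PresentedGroup.ext ?_
  rintro (i | j | _)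
  exacts [he i, hh j, hz]

theorem zpowers_zElt_le_center :
    Subgroup.zpowers (zElt n k m) ≤ Subgroup.center (ExtGroup n k m) := by
  rw [Subgroup.zpowers_le, ← Subgroup.centralizer_univ, ← Subgroup.coe_top,
    ← closure_generators_eq_top, Subgroup.centralizer_closure, Subgroup.mem_centralizer_iff]
  rintro _ (rfl | ⟨i, rfl⟩ | ⟨j, rfl⟩)
  · rfl
  · rw [← eElt_pow i]
    exact Commute.self_pow _ _
  · exact hElt_commute_zElt j

theorem zElt_zpow_commute (s : ℤ) (g : ExtGroup n k m) : Commute (zElt n k m ^ s) g :=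
  (Subgroup.mem_center_iff.1 (zpowers_zElt_le_center (Subgroup.zpow_mem_zpowers _ s)) g).symm

theorem zElt_commute (g : ExtGroup n k m) : Commute (zElt n k m) g := by
  simpa using zElt_zpow_commute 1 g

/-- The universal property of the presentation. -/
def lift {Q : Type*} [Group Q] (E : Fin k → Q) (H : Fin (2 * n) → Q) (Z : Q)
    (hE : ∀ i, E i ^ m i = Z) (hH : ∀ j, Commute (H j) Z) : ExtGroup n k m →* Q :=
  PresentedGroup.toGroup (f := fun x => match x with
    | .e i => E i
    | .h j => H j
    | .z => Z) (by
      rintro r (⟨i, rfl⟩ | ⟨j, rfl⟩)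
      · simp [hE]
      · simp [(hH j).eq])

section lift

variable {Q : Type*} [Group Q] {E : Fin k → Q} {H : Fin (2 * n) → Q} {Z : Q}
  {hE : ∀ i, E i ^ m i = Z} {hH : ∀ j, Commute (H j) Z}

@[simp]
theorem lift_eElt (i : Fin k) : lift E H Z hE hH (eElt n m i) = E i :=
  PresentedGroup.toGroup.of _

@[simp]
theorem lift_hElt (j : Fin (2 * n)) : lift E H Z hE hH (hElt m j) = H j :=
  PresentedGroup.toGroup.of _

@[simp]
theorem lift_zElt : lift E H Z hE hH (zElt n k m) = Z :=
  PresentedGroup.toGroup.of _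

end lift

/-- The projection onto the free product. -/
def toFreeProd (n : ℕ) (m : Fin k → ℕ) : ExtGroup n k m →* FreeProdCyclic n k m :=
  lift (Q := FreeProdCyclic n k m)
    (fun i => .inr (.of (M := fun i => Multiplicative (ZMod (m i))) (i := i) (.ofAdd 1)))
    (fun j => .inl (.of j)) 1
    (fun i => by
      rw [← map_pow, ← map_pow, ← ofAdd_nsmul, nsmul_one, ZMod.natCast_self, ofAdd_zero, map_one,
        map_one])
    (fun j => Commute.one_right _)

theorem toFreeProd_surjective : Function.Surjective (toFreeProd n m) := by
  suffices h : ⊤ ≤ (toFreeProd n m).range from fun x =>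
    MonoidHom.mem_range.1 (h (Subgroup.mem_top x))
  rw [← Monoid.Coprod.range_inl_sup_range_inr, sup_le_iff]
  constructor
  · rw [MonoidHom.range_eq_map, ← FreeGroup.closure_range_of, MonoidHom.map_closure,
      Subgroup.closure_le]
    rintro _ ⟨_, ⟨j, rfl⟩, rfl⟩
    exact ⟨hElt m j, lift_hElt j⟩
  · rintro _ ⟨x, rfl⟩
    induction x using Monoid.CoprodI.induction_on with
    | one =>
      rw [map_one]
      exact one_mem _
    | of i x =>
      obtain ⟨a, ha⟩ := ZMod.intCast_surjective (Multiplicative.toAdd x)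
      refine ⟨eElt n m i ^ a, ?_⟩
      rw [map_zpow, toFreeProd, lift_eElt, ← map_zpow, ← map_zpow, ← ofAdd_zsmul, zsmul_one, ha,
        ofAdd_toAdd]
    | mul x y hx hy =>
      rw [map_mul]
      exact mul_mem hx hy

theorem ker_toFreeProd : (toFreeProd n m).ker = Subgroup.zpowers (zElt n k m) := by
  have hz : toFreeProd n m (zElt n k m) = 1 := lift_zElt
  refine le_antisymm ?_ ((Subgroup.zpowers_le).2 hz)
  have : (Subgroup.zpowers (zElt n k m)).Normal :=
    ⟨fun g hg x => by
      rwa [Subgroup.mem_center_iff.1 (zpowers_zElt_le_center hg) x, mul_inv_cancel_right]⟩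
  let q := QuotientGroup.mk' (Subgroup.zpowers (zElt n k m))
  have hqz : q (zElt n k m) = 1 := (QuotientGroup.eq_one_iff _).2 (Subgroup.mem_zpowers _)
  have hq i : q (eElt n m i) ^ m i = 1 := by rw [← map_pow, eElt_pow, hqz]
  let toQuot : FreeProdCyclic n k m →* ExtGroup n k m ⧸ Subgroup.zpowers (zElt n k m) :=
    Monoid.Coprod.lift (FreeGroup.lift fun j => q (hElt m j))
      (Monoid.CoprodI.lift fun i => zmodPowersHom _ (hq i))
  have hcomp : toQuot.comp (toFreeProd n m) = q := by
    refine hom_ext ?_ (fun i => ?_) fun j => ?_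
    · rw [MonoidHom.comp_apply, hz, map_one, hqz]
    · simp [toQuot, toFreeProd, zmodPowersHom_ofAdd_one]
    · simp [toQuot, toFreeProd]
  intro g hg
  rw [← QuotientGroup.eq_one_iff]
  change q g = 1
  rw [← hcomp, MonoidHom.comp_apply, MonoidHom.mem_ker.1 hg, map_one]

/-- The homomorphism `z ↦ M`, `eᵢ ↦ M / mᵢ`, `hⱼ ↦ 0`, where `M = m₁ ⋯ m_k`. -/
def degHom (n : ℕ) (m : Fin k → ℕ) : ExtGroup n k m →* Multiplicative ℤ :=
  lift (fun i => .ofAdd (∏ j ∈ Finset.univ.erase i, m j)) 1 (.ofAdd (∏ i, m i))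
    (fun i => by
      rw [← ofAdd_nsmul, nsmul_eq_mul, ← Finset.mul_prod_erase _ _ (Finset.mem_univ i)])
    (fun _ => Commute.one_left _)

/-- The homomorphism `degHom` with values in the additive group `ℤ`. -/
def deg (g : ExtGroup n k m) : ℤ := (degHom n m g).toAdd

@[simp]
theorem deg_mul (g h : ExtGroup n k m) : deg (g * h) = deg g + deg h := by
  rw [deg, map_mul, toAdd_mul, deg, deg]

@[simp]
theorem deg_one : deg (1 : ExtGroup n k m) = 0 := by
  rw [deg, map_one, toAdd_one]

@[simp]
theorem deg_inv (g : ExtGroup n k m) : deg g⁻¹ = - deg g := by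
  rw [deg, map_inv, toAdd_inv, deg]

@[simp]
theorem deg_pow (g : ExtGroup n k m) (r : ℕ) : deg (g ^ r) = r * deg g := by
  rw [deg, map_pow, toAdd_pow, deg, nsmul_eq_mul]

@[simp]
theorem deg_zpow (g : ExtGroup n k m) (r : ℤ) : deg (g ^ r) = r * deg g := by
  rw [deg, map_zpow, toAdd_zpow, deg, smul_eq_mul]

@[simp]
theorem deg_zElt : deg (zElt n k m) = ∏ i, (m i : ℤ) := by
  rw [deg, degHom, lift_zElt, toAdd_ofAdd]

@[simp]
theorem deg_hElt (j : Fin (2 * n)) : deg (hElt m j) = 0 := by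
  rw [deg, degHom, lift_hElt, Pi.one_apply, toAdd_one]

theorem mul_deg_eElt (i : Fin k) : m i * deg (eElt n m i) = ∏ i, (m i : ℤ) := by
  rw [← deg_zElt (n := n), ← eElt_pow i, deg_pow]

theorem not_isOfFinOrder_zElt (hm : ∀ i, m i ≠ 0) : ¬ IsOfFinOrder (zElt n k m) := by
  rw [isOfFinOrder_iff_pow_eq_one]
  rintro ⟨d, hd, h⟩
  have hprod : ∏ i, (m i : ℤ) = 0 := by simpa [hd.ne'] using congrArg deg h
  obtain ⟨i, -, hi⟩ := Finset.prod_eq_zero_iff.1 hprod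
  exact hm i (by exact_mod_cast hi)

/-- The endomorphism that fixes the projection to the free product and multiplies the degree by
`1 + rM`. -/
def twist (n : ℕ) (m : Fin k → ℕ) (r : ℤ) : ExtGroup n k m →* ExtGroup n k m where
  toFun g := g * zElt n k m ^ (r * deg g)
  map_one' := by simp
  map_mul' g h := by
    rw [deg_mul, mul_add, zpow_add, (zElt_zpow_commute _ h).mul_mul_mul_comm]

theorem twist_apply (r : ℤ) (g : ExtGroup n k m) : twist n m r g = g * zElt n k m ^ (r * deg g) :=
  rfl

theorem deg_twist (r : ℤ) (g : ExtGroup n k m) :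
    deg (twist n m r g) = (1 + r * ∏ i, (m i : ℤ)) * deg g := by
  rw [twist_apply, deg_mul, deg_zpow, deg_zElt]
  ring

theorem twist_injective {r : ℤ} (hr : 1 + r * ∏ i, (m i : ℤ) ≠ 0) :
    Function.Injective (twist n m r) := by
  refine (injective_iff_map_eq_one _).2 fun g hg => ?_
  have hdeg : deg g = 0 := by simpa [deg_twist, hr] using congrArg deg hg
  simpa [twist_apply, hdeg] using hg

/-! ### Normal forms modulo `z` -/

/-- Letters for normal forms modulo `z`: the powers `eᵢ ^ (l + 1)` with `l + 1 < mᵢ`, and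
`hⱼ ^ ± 1`, where `true` stands for the exponent `1`. -/
abbrev Letter (n : ℕ) (m : Fin k → ℕ) : Type :=
  (Σ i : Fin k, Fin (m i - 1)) ⊕ (Fin (2 * n) × Bool)

/-- The block of the circle attracted by `hⱼ`. Each pair `h₂ₚ`, `h₂ₚ₊₁` has four consecutive
blocks, attracted by `h₂ₚ`, `h₂ₚ₊₁`, `h₂ₚ⁻¹` and `h₂ₚ₊₁⁻¹` in this order. -/
def handleBlock (k : ℕ) (j : Fin (2 * n)) : ℕ := k + 4 * ((j : ℕ) / 2) + (j : ℕ) % 2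

theorem handleBlock_add_two_lt (k : ℕ) (j : Fin (2 * n)) : handleBlock k j + 2 < k + 4 * n := by
  have := j.2
  simp only [handleBlock]
  omega

theorem handleBlock_injective {i j : Fin (2 * n)} (h : handleBlock k i = handleBlock k j) :
    i = j := by
  simp only [handleBlock] at h
  omega

theorem handleBlock_ne_add_two (k : ℕ) (i j : Fin (2 * n)) :
    handleBlock k i ≠ handleBlock k j + 2 := by
  simp only [handleBlock]
  omega

namespace Letter

/-- The group element of a letter. -/
def elt : Letter n m → ExtGroup n k m
  | .inl ⟨i, l⟩ => eElt n m i ^ ((l : ℕ) + 1)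
  | .inr (j, true) => hElt m j
  | .inr (j, false) => (hElt m j)⁻¹

/-- The block of the circle into which a letter maps the complement of its repelling block. -/
def attracting : Letter n m → ℕ
  | .inl ⟨i, _⟩ => i
  | .inr (j, true) => handleBlock k j
  | .inr (j, false) => handleBlock k j + 2

/-- The block of the circle whose complement a letter maps into its attracting block. -/
def repelling : Letter n m → ℕ
  | .inl ⟨i, _⟩ => i
  | .inr (j, true) => handleBlock k j + 2
  | .inr (j, false) => handleBlock k j

theorem attracting_lt (a : Letter n m) : a.attracting < k + 4 * n := by
  rcases a with ⟨i, l⟩ | ⟨j, _ | _⟩ <;> simp only [attracting]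
  · omega
  · exact handleBlock_add_two_lt k j
  · have := handleBlock_add_two_lt k j
    omega

theorem repelling_lt (a : Letter n m) : a.repelling < k + 4 * n := by
  rcases a with ⟨i, l⟩ | ⟨j, _ | _⟩ <;> simp only [repelling]
  · omega
  · have := handleBlock_add_two_lt k j
    omega
  · exact handleBlock_add_two_lt k j

theorem eElt_pow_mul_eElt_pow (i : Fin k) (l l' : Fin (m i - 1)) :
    (∃ s : ℤ, eElt n m i ^ ((l : ℕ) + 1) * eElt n m i ^ ((l' : ℕ) + 1) = zElt n k m ^ s) ∨
      ∃ (l'' : Fin (m i - 1)) (s : ℤ), eElt n m i ^ ((l : ℕ) + 1) * eElt n m i ^ ((l' : ℕ) + 1) =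
        eElt n m i ^ ((l'' : ℕ) + 1) * zElt n k m ^ s := by
  rw [← pow_add]
  rcases lt_trichotomy ((l : ℕ) + 1 + (l' + 1)) (m i) with h | h | h
  · exact .inr ⟨⟨l + 1 + l', by omega⟩, 0, by simp [add_assoc]⟩
  · exact .inl ⟨1, by rw [h, eElt_pow, zpow_one]⟩
  · refine .inr ⟨⟨l + l' + 1 - m i, by omega⟩, 1, ?_⟩
    rw [zpow_one, ← eElt_pow i, ← pow_add]
    congr 1
    dsimp only
    omega

theorem elt_mul_elt_of_repelling_eq {a b : Letter n m} (h : a.repelling = b.attracting) :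
    (∃ s : ℤ, a.elt * b.elt = zElt n k m ^ s) ∨
      ∃ (c : Letter n m) (s : ℤ), a.elt * b.elt = c.elt * zElt n k m ^ s ∧
        c.repelling = b.repelling ∧ c.attracting = a.attracting := by
  have hk (j : Fin (2 * n)) : k ≤ handleBlock k j := by simp only [handleBlock]; omega
  rcases a with ⟨i, l⟩ | ⟨j, _ | _⟩ <;> rcases b with ⟨i', l'⟩ | ⟨j', _ | _⟩ <;>
    simp only [attracting, repelling] at h
  · obtain rfl : i = i' := Fin.ext h
    obtain hs | ⟨l'', s, hs⟩ := eElt_pow_mul_eElt_pow (n := n) i l l'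
    exacts [.inl hs, .inr ⟨.inl ⟨i, l''⟩, s, hs, rfl, rfl⟩]
  · have := hk j'
    omega
  · have := hk j'
    omega
  · have := hk j
    omega
  · exact absurd h (handleBlock_ne_add_two k j j')
  · obtain rfl := handleBlock_injective h
    exact .inl ⟨0, by simp [elt]⟩
  · have := hk j
    omega
  · obtain rfl := handleBlock_injective (Nat.add_right_cancel h)
    exact .inl ⟨0, by simp [elt]⟩
  · exact absurd h.symm (handleBlock_ne_add_two k j' j)

theorem exists_avoiding (hk : 1 ≤ k) (hm : ∀ i, 2 ≤ m i) (hK : 2 ≤ k + 4 * n) (q : ℕ) :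
    ∃ b : Letter n m, b.attracting ≠ q ∧ b.repelling ≠ q := by
  let power (i : Fin k) : Letter n m := .inl ⟨i, 0, by have := hm i; omega⟩
  by_cases hq : q = 0
  · subst hq
    by_cases h2 : 2 ≤ k
    · exact ⟨power ⟨1, h2⟩, one_ne_zero, one_ne_zero⟩
    · refine ⟨.inr (⟨0, by omega⟩, true), ?_, ?_⟩ <;>
        simp only [attracting, repelling, handleBlock] <;> omega
  · exact ⟨power ⟨0, hk⟩, Ne.symm hq, Ne.symm hq⟩

end Letter

/-- The product of a word. -/
def wordElt (l : List (Letter n m)) : ExtGroup n k m := (l.map Letter.elt).prod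

@[simp]
theorem wordElt_nil : wordElt ([] : List (Letter n m)) = 1 := rfl

@[simp]
theorem wordElt_cons (a : Letter n m) (l : List (Letter n m)) :
    wordElt (a :: l) = a.elt * wordElt l := by
  simp [wordElt]

/-- Words in which no two neighbours can be merged. -/
abbrev Reduced (l : List (Letter n m)) : Prop :=
  l.IsChain fun a b => a.repelling ≠ b.attracting

theorem exists_reduced_cons (a : Letter n m) {l : List (Letter n m)} (hl : Reduced l) :
    ∃ (l' : List (Letter n m)) (s : ℤ), Reduced l' ∧
      a.elt * wordElt l = wordElt l' * zElt n k m ^ s := by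
  rcases l with _ | ⟨b, l⟩
  · exact ⟨[a], 0, List.isChain_singleton a, by simp⟩
  by_cases hab : a.repelling = b.attracting
  · obtain ⟨s, hs⟩ | ⟨c, s, hs, hc, -⟩ := Letter.elt_mul_elt_of_repelling_eq hab
    · refine ⟨l, s, hl.tail, ?_⟩
      rw [wordElt_cons, ← mul_assoc, hs, (zElt_zpow_commute s _).eq]
    · refine ⟨c :: l, s, ?_, ?_⟩
      · rw [Reduced, List.isChain_cons] at hl ⊢
        exact ⟨fun d hd => hc ▸ hl.1 d hd, hl.2⟩
      · rw [wordElt_cons, ← mul_assoc, hs, wordElt_cons, mul_assoc, mul_assoc,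
          (zElt_zpow_commute s _).eq]
  · exact ⟨a :: b :: l, 0, List.isChain_cons_cons.2 ⟨hab, hl⟩, by simp⟩

theorem exists_reduced_mul_elt (b : Letter n m) (a : Letter n m) (l : List (Letter n m))
    (hl : Reduced (a :: l)) : ∃ (l' : List (Letter n m)) (s : ℤ), Reduced l' ∧
      wordElt (a :: l) * b.elt = wordElt l' * zElt n k m ^ s ∧
      ∀ d ∈ l'.head?, d.attracting = a.attracting := by
  induction l generalizing a with
  | nil =>
    by_cases hab : a.repelling = b.attracting
    · obtain ⟨s, hs⟩ | ⟨c, s, hs, -, hc⟩ := Letter.elt_mul_elt_of_repelling_eq hab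
      · exact ⟨[], s, List.isChain_nil, by simp [hs], by simp⟩
      · exact ⟨[c], s, List.isChain_singleton c, by simp [hs], by simp [hc]⟩
    · exact ⟨[a, b], 0, List.isChain_pair.2 hab, by simp, by simp⟩
  | cons d l ih =>
    obtain ⟨l', s, hl', hs, hhead⟩ := ih d hl.tail
    refine ⟨a :: l', s, List.isChain_cons.2 ⟨fun c hc => ?_, hl'⟩, ?_, by simp⟩
    · rw [hhead c hc]
      exact (List.isChain_cons_cons.1 hl).1
    · rw [wordElt_cons, mul_assoc, hs, wordElt_cons, mul_assoc]

theorem exists_reduced (hm : ∀ i, 2 ≤ m i) (g : ExtGroup n k m) :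
    ∃ (l : List (Letter n m)) (s : ℤ), Reduced l ∧ g = wordElt l * zElt n k m ^ s := by
  let NormalForm (g : ExtGroup n k m) : Prop :=
    ∃ (l : List (Letter n m)) (s : ℤ), Reduced l ∧ g = wordElt l * zElt n k m ^ s
  have letter_mul (a : Letter n m) (g) : NormalForm g → NormalForm (a.elt * g) := by
    rintro ⟨l, s, hl, rfl⟩
    obtain ⟨l', s', hl', h⟩ := exists_reduced_cons a hl
    exact ⟨l', s' + s, hl', by rw [← mul_assoc, h, mul_assoc, zpow_add]⟩
  have z_mul (s : ℤ) (g) : NormalForm g → NormalForm (zElt n k m ^ s * g) := by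
    rintro ⟨l, s', hl, rfl⟩
    exact ⟨l, s + s', hl, by rw [zpow_add, ← mul_assoc, (zElt_zpow_commute s _).eq, mul_assoc]⟩
  have hg := Subgroup.mem_top g
  rw [← closure_generators_eq_top] at hg
  induction hg using Subgroup.closure_induction_left with
  | one => exact ⟨[], 0, List.isChain_nil, by simp⟩
  | mul_left x hx y _ ih =>
    obtain rfl | ⟨i, rfl⟩ | ⟨j, rfl⟩ := hx
    · simpa only [zpow_one] using z_mul 1 y ih
    · simpa only [Letter.elt, zero_add, pow_one] using
        letter_mul (.inl ⟨i, 0, by have := hm i; omega⟩) y ih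
    · exact letter_mul (.inr (j, true)) y ih
  | inv_mul_cancel x hx y _ ih =>
    obtain rfl | ⟨i, rfl⟩ | ⟨j, rfl⟩ := hx
    · simpa only [zpow_neg_one] using z_mul (-1) y ih
    · have hi := hm i
      have hinv : (eElt n m i)⁻¹ = zElt n k m ^ (-1 : ℤ) * eElt n m i ^ (m i - 2 + 1) := by
        rw [zpow_neg_one, eq_inv_mul_iff_mul_eq, ← eElt_pow i, mul_inv_eq_iff_eq_mul, ← pow_succ]
        congr 1
        omega
      rw [hinv, mul_assoc]
      exact z_mul _ _ (letter_mul (.inl ⟨i, ⟨m i - 2, by omega⟩⟩) y ih)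
    · exact letter_mul (.inr (j, false)) y ih

variable {r : ℤ}

/-! ### Cut systems -/

/-- The number of blocks into which the circle is cut: one for each attracting block of a letter,
and the cusp block. -/
def period (n k : ℕ) : ℤ := k + 4 * n + 1

theorem period_pos : 0 < period n k := by
  simp only [period]
  omega

namespace Letter

theorem attracting_cast_lt (a : Letter n m) : (a.attracting : ℤ) < period n k - 1 := by
  have := a.attracting_lt
  simp only [period]
  omega

theorem repelling_cast_lt (a : Letter n m) : (a.repelling : ℤ) < period n k - 1 := by
  have := a.repelling_lt
  simp only [period]
  omega

/-- The number of turns lost by a letter on its way from the left of the repelling block to the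
attracting block. -/
def shift : Letter n m → ℤ
  | .inr (_, false) => -1
  | _ => 0

end Letter

/-- The index `p` such that the product of a reduced word moves the base point `cut 0` into the
block `(cut p, cut (p + 1)]` of every cut system of twist `r`. -/
def level (r : ℤ) : List (Letter n m) → ℤ
  | [] => -1
  | a :: l => a.attracting +
      period n k * (a.shift + r * deg a.elt + (level r l - a.repelling) / period n k + 1)

theorem level_cons_emod (a : Letter n m) (l : List (Letter n m)) :
    level r (a :: l) % period n k = a.attracting := by
  have := a.attracting_cast_lt
  rw [level, Int.add_mul_emod_self_left, Int.emod_eq_of_lt (by omega) (by omega)]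

theorem level_emod_ne_repelling {a : Letter n m} {l : List (Letter n m)} (hl : Reduced (a :: l)) :
    level r l % period n k ≠ a.repelling := by
  rcases l with _ | ⟨b, l⟩
  · have := a.repelling_cast_lt
    rw [level, ← Int.add_emod_right, Int.emod_eq_of_lt (by omega) (by omega)]
    omega
  · rw [level_cons_emod]
    exact_mod_cast (List.isChain_cons_cons.1 hl).1.symm

/-- An action of the group on a linear order together with a periodic sequence of cut points on
which the generators act as on the standard cuts of the line, up to `r * deg` additional turns. -/
structure CutSystem (n : ℕ) (m : Fin k → ℕ) (r : ℤ) (Ω : Type*) [LinearOrder Ω] where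
  act : ExtGroup n k m →* Ω ≃o Ω
  cut : ℤ → Ω
  cut_mono : Monotone cut
  act_zElt p : act (zElt n k m) (cut p) = cut (p + period n k * (1 + r * ∏ i, (m i : ℤ)))
  act_eElt i s : act (eElt n m i) (cut (i + 1 + period n k * s)) =
    cut (i + period n k * (s + 1 + r * deg (eElt n m i)))
  act_hElt_lower j s : act (hElt m j) (cut (handleBlock k j + 2 + 1 + period n k * s)) =
    cut (handleBlock k j + period n k * (s + 1))
  act_hElt_upper j s : act (hElt m j) (cut (handleBlock k j + 2 + period n k * s)) =
    cut (handleBlock k j + 1 + period n k * s)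

namespace CutSystem

variable {Ω : Type*} [LinearOrder Ω] (S : CutSystem n m r Ω)

theorem act_inv_eq_iff (g : ExtGroup n k m) {x y : Ω} : S.act g⁻¹ x = y ↔ x = S.act g y := by
  rw [map_inv]
  exact (S.act g).symm_apply_eq

theorem act_zElt_zpow (s p : ℤ) : S.act (zElt n k m ^ s) (S.cut p) =
    S.cut (p + period n k * (1 + r * ∏ i, (m i : ℤ)) * s) := by
  induction s with
  | zero => simp
  | succ s ih =>
    rw [add_comm, zpow_one_add, map_mul, RelIso.mul_apply, ih, S.act_zElt]
    congr 1
    ring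
  | pred s ih =>
    rw [sub_eq_neg_add, zpow_add, zpow_neg_one, map_mul, RelIso.mul_apply, ih,
      S.act_inv_eq_iff, S.act_zElt]
    congr 1
    ring

theorem le_act_eElt_pow (i : Fin k) (t : ℕ) (s : ℤ) :
    S.cut (i + period n k * (s + 1 + r * ((t + 1) * deg (eElt n m i)))) ≤
      S.act (eElt n m i ^ (t + 1)) (S.cut (i + 1 + period n k * s)) := by
  induction t with
  | zero => simp [S.act_eElt]
  | succ t ih =>
    rw [pow_succ', map_mul, RelIso.mul_apply]
    set s' := s + r * ((t + 1) * deg (eElt n m i)) with hs'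
    calc
      _ = S.act (eElt n m i) (S.cut (i + 1 + period n k * s')) := by
        rw [S.act_eElt, hs']
        push_cast
        ring_nf
      _ ≤ S.act (eElt n m i)
          (S.cut (i + period n k * (s + 1 + r * ((t + 1) * deg (eElt n m i))))) :=
        (S.act _).monotone (S.cut_mono (by linarith [period_pos (n := n) (k := k)]))
      _ ≤ _ := (S.act _).monotone ih

theorem lt_act_elt (a : Letter n m) (s : ℤ) {y : Ω}
    (hy : S.cut (a.repelling + 1 + period n k * (s - 1)) < y) :
    S.cut (a.attracting + period n k * (s + a.shift + r * deg a.elt)) < S.act a.elt y := by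
  refine lt_of_le_of_lt ?_ ((S.act a.elt).strictMono hy)
  rcases a with ⟨i, l⟩ | ⟨j, _ | _⟩
  · refine le_trans (le_of_eq ?_) (S.le_act_eElt_pow i l (s - 1))
    simp [Letter.attracting, Letter.shift, Letter.elt]
  · refine le_of_eq ?_
    rw [Letter.elt, eq_comm, S.act_inv_eq_iff]
    simpa [Letter.attracting, Letter.repelling, Letter.shift, sub_eq_add_neg] using
      (S.act_hElt_upper j (s - 1)).symm
  · refine le_of_eq ?_
    simpa [Letter.attracting, Letter.repelling, Letter.shift, Letter.elt] using
      (S.act_hElt_lower j (s - 1)).symm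

theorem act_elt_le (a : Letter n m) (s : ℤ) {y : Ω}
    (hy : y ≤ S.cut (a.repelling + period n k * s)) :
    S.act a.elt y ≤ S.cut (a.attracting + 1 + period n k * (s + a.shift + r * deg a.elt)) := by
  refine ((S.act a.elt).monotone hy).trans ?_
  rcases a with ⟨i, l⟩ | ⟨j, _ | _⟩
  · -- `eᵢ ^ (l + 1) = z * (eᵢ ^ (t + 1))⁻¹`, so a lower bound for `eᵢ ^ (t + 1)` suffices
    obtain ⟨t, ht⟩ : ∃ t : ℕ, m i = t + 1 + (l + 1) := ⟨m i - (l + 1) - 1, by omega⟩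
    rw [← (S.act (eElt n m i ^ (t + 1))).le_iff_le, ← RelIso.mul_apply, ← map_mul, Letter.elt,
      ← pow_add, ← ht, eElt_pow, Letter.repelling, S.act_zElt, ← mul_deg_eElt (n := n) i]
    refine le_trans (le_of_eq (congrArg S.cut ?_)) (S.le_act_eElt_pow i t _)
    have hti : (m i : ℤ) = t + 1 + (l + 1) := by exact_mod_cast ht
    simp only [Letter.shift, deg_pow, hti]
    push_cast
    ring
  · refine le_of_eq ?_
    rw [Letter.elt, S.act_inv_eq_iff]
    simpa [Letter.attracting, Letter.repelling, Letter.shift] using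
      (S.act_hElt_lower j (s + -1)).symm
  · refine le_of_eq ?_
    simpa [Letter.attracting, Letter.repelling, Letter.shift, Letter.elt] using
      S.act_hElt_upper j s

theorem act_elt_mem_Ioc (a : Letter n m) {p : ℤ} (hp : p % period n k ≠ a.repelling) {y : Ω}
    (hy : y ∈ Set.Ioc (S.cut p) (S.cut (p + 1))) :
    S.act a.elt y ∈ Set.Ioc
      (S.cut (a.attracting +
        period n k * ((p - a.repelling) / period n k + 1 + a.shift + r * deg a.elt)))
      (S.cut (a.attracting + 1 +
        period n k * ((p - a.repelling) / period n k + 1 + a.shift + r * deg a.elt))) := by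
  have ha := a.repelling_cast_lt
  have hdiv := Int.mul_ediv_add_emod (p - a.repelling) (period n k)
  have hlt := Int.emod_lt_of_pos (p - a.repelling) (period_pos (n := n) (k := k))
  have hpos : 0 < (p - a.repelling) % period n k := by
    refine lt_of_le_of_ne (Int.emod_nonneg _ period_pos.ne') fun h => hp ?_
    rw [Int.emod_emod_of_dvd _ dvd_rfl |>.symm, Int.emod_eq_emod_iff_emod_sub_eq_zero.2 h.symm,
      Int.emod_emod_of_dvd _ dvd_rfl, Int.emod_eq_of_lt (by omega) (by omega)]
  exact ⟨S.lt_act_elt a _ ((S.cut_mono (by linarith)).trans_lt hy.1),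
    S.act_elt_le a _ (hy.2.trans (S.cut_mono (by linarith)))⟩

theorem act_wordElt_mem_Ioc {l : List (Letter n m)} (hl : Reduced l)
    (hcut : S.cut (-1) < S.cut 0) :
    S.act (wordElt l) (S.cut 0) ∈ Set.Ioc (S.cut (level r l)) (S.cut (level r l + 1)) := by
  induction l with
  | nil => simpa [level] using hcut
  | cons a l ih =>
    rw [wordElt_cons, map_mul, RelIso.mul_apply]
    convert S.act_elt_mem_Ioc a (level_emod_ne_repelling hl) (ih hl.tail) using 2 <;>
      rw [level] <;> congr 1 <;> ring

theorem act_wordElt_mul_zpow_mem_Ioc {l : List (Letter n m)} (hl : Reduced l) (s : ℤ)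
    (hcut : S.cut (-1) < S.cut 0) :
    S.act (wordElt l * zElt n k m ^ s) (S.cut 0) ∈ Set.Ioc
      (S.cut (level r l + period n k * (1 + r * ∏ i, (m i : ℤ)) * s))
      (S.cut (level r l + period n k * (1 + r * ∏ i, (m i : ℤ)) * s + 1)) := by
  obtain ⟨h₁, h₂⟩ := S.act_wordElt_mem_Ioc hl hcut
  rw [← (zElt_zpow_commute s _).eq, map_mul, RelIso.mul_apply, add_right_comm, ← S.act_zElt_zpow,
    ← S.act_zElt_zpow]
  exact ⟨(S.act _).strictMono h₁, (S.act _).monotone h₂⟩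

theorem lt_act_wordElt_mul_zpow_iff {l : List (Letter n m)} (hl : Reduced l) (s : ℤ)
    (hcut : S.cut (-1) < S.cut 0) :
    S.cut 0 < S.act (wordElt l * zElt n k m ^ s) (S.cut 0) ↔
      0 ≤ level r l + period n k * (1 + r * ∏ i, (m i : ℤ)) * s := by
  obtain ⟨h₁, h₂⟩ := S.act_wordElt_mul_zpow_mem_Ioc hl s hcut
  refine ⟨fun h => ?_, fun h => (S.cut_mono h).trans_lt h₁⟩
  by_contra! hneg
  exact (h.trans_le h₂).not_ge (S.cut_mono hneg)

theorem lt_act_iff_lt_act {Ω' : Type*} [LinearOrder Ω'] (S' : CutSystem n m r Ω')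
    (hcut : S.cut (-1) < S.cut 0) (hcut' : S'.cut (-1) < S'.cut 0) (hm : ∀ i, 2 ≤ m i)
    (g : ExtGroup n k m) :
    S.cut 0 < S.act g (S.cut 0) ↔ S'.cut 0 < S'.act g (S'.cut 0) := by
  obtain ⟨l, s, hl, rfl⟩ := exists_reduced hm g
  rw [S.lt_act_wordElt_mul_zpow_iff hl s hcut, S'.lt_act_wordElt_mul_zpow_iff hl s hcut']

theorem eq_one_of_act_mem_Ioc (hcut : S.cut (-1) < S.cut 0) (hm : ∀ i, 2 ≤ m i)
    (hr : 1 + r * ∏ i, (m i : ℤ) ≠ 0) {g : ExtGroup n k m}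
    (hg : S.act g (S.cut 0) ∈ Set.Ioc (S.cut (-1)) (S.cut 0)) : g = 1 := by
  obtain ⟨l, s, hl, rfl⟩ := exists_reduced hm g
  obtain ⟨h₁, h₂⟩ := S.act_wordElt_mul_zpow_mem_Ioc hl s hcut
  have hlevel : level r l + period n k * (1 + r * ∏ i, (m i : ℤ)) * s = -1 := by
    have hlt := S.cut_mono.reflect_lt (h₁.trans_le hg.2)
    have hgt := S.cut_mono.reflect_lt (hg.1.trans_le h₂)
    omega
  rcases l with _ | ⟨a, l⟩
  · have hs : s = 0 := by simpa [level, period_pos.ne', hr] using hlevel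
    simp [hs]
  · have hmod := congrArg (· % period n k) hlevel
    have ha := a.attracting_cast_lt
    simp only [mul_assoc, Int.add_mul_emod_self_left, level_cons_emod] at hmod
    rw [← Int.add_emod_right, Int.emod_eq_of_lt (by omega) (by omega)] at hmod
    omega

end CutSystem

/-! ### The elements carrying the base point to the cut points -/

/-- The index of the first generator of the `t`-th pair. -/
def evenIndex (t : Fin n) : Fin (2 * n) := ⟨2 * t, by omega⟩

/-- The index of the second generator of the `t`-th pair. -/
def oddIndex (t : Fin n) : Fin (2 * n) := ⟨2 * t + 1, by omega⟩

theorem exists_eq_evenIndex_or_oddIndex (j : Fin (2 * n)) :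
    ∃ t, j = evenIndex t ∨ j = oddIndex t := by
  refine ⟨⟨j / 2, by omega⟩, ?_⟩
  simp only [Fin.ext_iff, evenIndex, oddIndex]
  omega

theorem handleBlock_evenIndex (t : Fin n) : handleBlock k (evenIndex t) = k + 4 * t := by
  simp only [handleBlock, evenIndex]
  omega

theorem handleBlock_oddIndex (t : Fin n) : handleBlock k (oddIndex t) = k + 4 * t + 1 := by
  simp only [handleBlock, oddIndex]
  omega

/-- The factors that carry each cut point to the next one across the four blocks of the `t`-th pair
of generators `hⱼ`, solved from `hElt_mul_cutElt_upper` and `hElt_mul_cutElt_lower`. -/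
def handleStep (m : Fin k → ℕ) (t : Fin n) : Fin 4 → ExtGroup n k m :=
  let a := hElt m (evenIndex t)
  let b := hElt m (oddIndex t)
  ![zElt n k m * a * b * a⁻¹, a⁻¹, b⁻¹, zElt n k m * b⁻¹ * a * b]

/-- The element that carries the `q`-th cut point to the next one. -/
def cutStep (n : ℕ) (m : Fin k → ℕ) (q : ℕ) : ExtGroup n k m :=
  if h : q < k then eElt n m ⟨q, h⟩ ^ (m ⟨q, h⟩ - 1)
  else if h : (q - k) / 4 < n then handleStep m ⟨(q - k) / 4, h⟩ (Fin.ofNat 4 (q - k))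
  else 1

/-- The element that carries the base point to the `q`-th cut point within one period. -/
def cutElt (n : ℕ) (m : Fin k → ℕ) : ℕ → ExtGroup n k m
  | 0 => 1
  | q + 1 => cutStep n m q * cutElt n m q

theorem cutElt_succ (q : ℕ) : cutElt n m (q + 1) = cutStep n m q * cutElt n m q := rfl

theorem cutStep_of_lt (i : Fin k) : cutStep n m i = eElt n m i ^ (m i - 1) := by
  rw [cutStep, dif_pos i.2]

theorem cutStep_handle (t : Fin n) (ρ : Fin 4) :
    cutStep n m (k + 4 * t + ρ) = handleStep m t ρ := by
  have ht : (k + 4 * t + ρ - k) / 4 = (t : ℕ) := by omega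
  have hρ : Fin.ofNat 4 (k + 4 * t + ρ - k) = ρ := by
    ext
    simp only [Fin.val_ofNat]
    omega
  rw [cutStep, dif_neg (by omega), dif_pos (by omega), hρ]
  congr

theorem eElt_mul_cutElt (hm : ∀ i, m i ≠ 0) (i : Fin k) :
    eElt n m i * cutElt n m (i + 1) = zElt n k m * cutElt n m i := by
  rw [cutElt_succ, cutStep_of_lt, ← mul_assoc, mul_pow_sub_one (hm i), eElt_pow]

theorem cutElt_handle (t : Fin n) (ρ : Fin 4) : cutElt n m (k + 4 * t + ρ + 1) =
    handleStep m t ρ * cutElt n m (k + 4 * t + ρ) := by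
  rw [cutElt_succ, cutStep_handle]

theorem cutElt_handle_steps (t : Fin n) :
    cutElt n m (k + 4 * t + 1) = handleStep m t 0 * cutElt n m (k + 4 * t) ∧
    cutElt n m (k + 4 * t + 2) = handleStep m t 1 * cutElt n m (k + 4 * t + 1) ∧
    cutElt n m (k + 4 * t + 3) = handleStep m t 2 * cutElt n m (k + 4 * t + 2) ∧
    cutElt n m (k + 4 * (t + 1)) = handleStep m t 3 * cutElt n m (k + 4 * t + 3) :=
  ⟨cutElt_handle t 0, cutElt_handle t 1, cutElt_handle t 2, cutElt_handle t 3⟩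

theorem hElt_mul_cutElt_upper (j : Fin (2 * n)) :
    hElt m j * cutElt n m (handleBlock k j + 2) = cutElt n m (handleBlock k j + 1) := by
  obtain ⟨t, rfl | rfl⟩ := exists_eq_evenIndex_or_oddIndex j
  · rw [handleBlock_evenIndex]
    exact mul_eq_of_eq_inv_mul (cutElt_handle t 1)
  · rw [handleBlock_oddIndex]
    exact mul_eq_of_eq_inv_mul (cutElt_handle t 2)

theorem hElt_mul_cutElt_lower (j : Fin (2 * n)) :
    hElt m j * cutElt n m (handleBlock k j + 2 + 1) =
      zElt n k m * cutElt n m (handleBlock k j) := by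
  have left_comm (g h : ExtGroup n k m) : g * (zElt n k m * h) = zElt n k m * (g * h) :=
    (zElt_commute g).symm.left_comm h
  obtain ⟨t, rfl | rfl⟩ := exists_eq_evenIndex_or_oddIndex j <;>
    obtain ⟨h₀, h₁, h₂, h₃⟩ := cutElt_handle_steps (m := m) t
  · rw [handleBlock_evenIndex, h₂, h₁, h₀]
    simp [handleStep, mul_assoc, left_comm]
  · rw [handleBlock_oddIndex, show k + 4 * t + 1 + 2 + 1 = k + 4 * (t + 1) by ring, h₃, h₂, h₁]
    simp [handleStep, mul_assoc, left_comm]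

/-- The cut elements indexed by `ℤ`: the element that carries the base point to the `p`-th cut
point. -/
def cutPoint (n : ℕ) (m : Fin k → ℕ) (p : ℤ) : ExtGroup n k m :=
  zElt n k m ^ (p / period n k) * cutElt n m (p % period n k).toNat

theorem cutPoint_natCast_add_mul {q : ℕ} (hq : q ≤ k + 4 * n) (s : ℤ) :
    cutPoint n m (q + period n k * s) = zElt n k m ^ s * cutElt n m q := by
  have hlt : (q : ℤ) < period n k := by
    simp only [period]
    omega
  rw [cutPoint, Int.add_mul_ediv_left _ _ period_pos.ne', Int.add_mul_emod_self_left,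
    Int.ediv_eq_zero_of_lt (Int.natCast_nonneg q) hlt, Int.emod_eq_of_lt (Int.natCast_nonneg q) hlt,
    zero_add, Int.toNat_natCast]

theorem cutPoint_add_mul (p s : ℤ) :
    cutPoint n m (p + period n k * s) = zElt n k m ^ s * cutPoint n m p := by
  rw [cutPoint, Int.add_mul_ediv_left _ _ period_pos.ne', Int.add_mul_emod_self_left, add_comm,
    zpow_add, mul_assoc, cutPoint]

theorem cutPoint_zero : cutPoint n m 0 = 1 := by
  simp [cutPoint, cutElt]

theorem mul_cutPoint {g : ExtGroup n k m} {q q' : ℕ} {s' : ℤ} (hq : q ≤ k + 4 * n)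
    (hq' : q' ≤ k + 4 * n) (h : g * cutElt n m q = zElt n k m ^ s' * cutElt n m q') (s : ℤ) :
    g * cutPoint n m (q + period n k * s) = cutPoint n m (q' + period n k * (s + s')) := by
  rw [cutPoint_natCast_add_mul hq, cutPoint_natCast_add_mul hq', zpow_add, mul_assoc, ← h,
    (zElt_zpow_commute s g).symm.left_comm]

theorem zElt_mul_cutPoint (p : ℤ) :
    zElt n k m * cutPoint n m p = cutPoint n m (p + period n k) := by
  simpa using (cutPoint_add_mul p 1).symm

theorem eElt_mul_cutPoint (hm : ∀ i, m i ≠ 0) (i : Fin k) (s : ℤ) :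
    eElt n m i * cutPoint n m (i + 1 + period n k * s) =
      cutPoint n m (i + period n k * (s + 1)) := by
  exact_mod_cast mul_cutPoint (q := i + 1) (by omega) (by omega)
    ((eElt_mul_cutElt hm i).trans (by rw [zpow_one])) s

theorem hElt_mul_cutPoint_lower (j : Fin (2 * n)) (s : ℤ) :
    hElt m j * cutPoint n m (handleBlock k j + 2 + 1 + period n k * s) =
      cutPoint n m (handleBlock k j + period n k * (s + 1)) := by
  have := handleBlock_add_two_lt k j
  exact_mod_cast mul_cutPoint (q := handleBlock k j + 2 + 1) (by omega) (by omega)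
    ((hElt_mul_cutElt_lower j).trans (by rw [zpow_one])) s

theorem hElt_mul_cutPoint_upper (j : Fin (2 * n)) (s : ℤ) :
    hElt m j * cutPoint n m (handleBlock k j + 2 + period n k * s) =
      cutPoint n m (handleBlock k j + 1 + period n k * s) := by
  have := handleBlock_add_two_lt k j
  have h := mul_cutPoint (m := m) (q := handleBlock k j + 2) (q' := handleBlock k j + 1) (s' := 0)
    (by omega) (by omega) ((hElt_mul_cutElt_upper j).trans (by rw [zpow_zero, one_mul])) s
  rw [add_zero] at h
  exact_mod_cast h

/-- The generator of the stabilizer of the cusp block, directed to the left. -/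
def cuspElt (n : ℕ) (m : Fin k → ℕ) : ExtGroup n k m :=
  (zElt n k m)⁻¹ * cutElt n m (k + 4 * n)

theorem cutPoint_neg_one : cutPoint n m (-1) = cuspElt n m := by
  have h := cutPoint_natCast_add_mul (n := n) (m := m) le_rfl (-1)
  rw [zpow_neg_one] at h
  rw [cuspElt, ← h]
  congr 1
  simp only [period]
  push_cast
  ring

theorem deg_cutElt_of_le (hm : ∀ i, m i ≠ 0) (q : ℕ) (hq : q ≤ k) : deg (cutElt n m q) =
    ∑ i : Fin q, (m (Fin.castLE hq i) - 1) * deg (eElt n m (Fin.castLE hq i)) := by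
  induction q with
  | zero => simp [cutElt]
  | succ q ih =>
    have h := hm ⟨q, hq⟩
    rw [cutElt_succ, deg_mul, ih (by omega), Fin.sum_univ_castSucc, add_comm]
    congr 1
    rw [cutStep_of_lt ⟨q, hq⟩, deg_pow, Nat.cast_pred (Nat.pos_of_ne_zero h)]
    rfl

theorem deg_handleStep (t : Fin n) : ∑ ρ, deg (handleStep m t ρ) = 2 * ∏ i, (m i : ℤ) := by
  simp [handleStep, Fin.sum_univ_four, two_mul]

theorem deg_cutElt_handle (t : ℕ) (ht : t ≤ n) : deg (cutElt n m (k + 4 * t)) =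
    deg (cutElt n m k) + 2 * t * ∏ i, (m i : ℤ) := by
  induction t with
  | zero => simp
  | succ t ih =>
    obtain ⟨h₀, h₁, h₂, h₃⟩ := cutElt_handle_steps (m := m) ⟨t, ht⟩
    have hsum := deg_handleStep (m := m) ⟨t, ht⟩
    rw [Fin.sum_univ_four] at hsum
    rw [h₃, deg_mul, h₂, deg_mul, h₁, deg_mul, h₀, deg_mul, ih (by omega)]
    push_cast
    linarith

theorem two_mul_deg_cuspElt (hm : ∀ i, m i ≠ 0) : 2 * deg (cuspElt n m) =
    ∑ i, (m i - 2) * deg (eElt n m i) + (k + 4 * n - 2) * ∏ i, (m i : ℤ) := by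
  have hsum : ∑ i, ((m i - 2) * deg (eElt n m i)) + k * ∏ i, (m i : ℤ) =
      2 * ∑ i, (m i - 1) * deg (eElt n m i) := by
    have hk : k * ∏ i, (m i : ℤ) = ∑ _i : Fin k, ∏ i, (m i : ℤ) := by simp
    rw [hk, ← Finset.sum_add_distrib, Finset.mul_sum]
    refine Finset.sum_congr rfl fun i _ => ?_
    rw [← mul_deg_eElt (n := n) i]
    ring
  rw [cuspElt, deg_mul, deg_inv, deg_zElt, deg_cutElt_handle n le_rfl,
    deg_cutElt_of_le hm k le_rfl]
  simp only [Fin.castLE_rfl, id]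
  linarith

theorem deg_cuspElt_pos (hk : 1 ≤ k) (hm : ∀ i, 2 ≤ m i) (h₁ : ¬ (n = 0 ∧ k = 1))
    (h₂ : ¬ (n = 0 ∧ k = 2 ∧ ∀ i, m i = 2)) : 0 < deg (cuspElt n m) := by
  have hM : 0 < ∏ i, (m i : ℤ) := Finset.prod_pos fun i _ => by have := hm i; omega
  have hpos (i) : 0 < deg (eElt n m i) := by
    rw [← mul_deg_eElt (n := n) i] at hM
    exact pos_of_mul_pos_right hM (Int.natCast_nonneg _)
  have hnonneg (i) (_ : i ∈ Finset.univ) : 0 ≤ ((m i : ℤ) - 2) * deg (eElt n m i) :=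
    mul_nonneg (by have := hm i; omega) (hpos i).le
  suffices 0 < 2 * deg (cuspElt n m) by omega
  rw [two_mul_deg_cuspElt fun i => by have := hm i; omega]
  rcases (show 2 < k + 4 * n ∨ n = 0 ∧ k = 2 by omega) with hK | ⟨rfl, rfl⟩
  · exact add_pos_of_nonneg_of_pos (Finset.sum_nonneg hnonneg) (mul_pos (by omega) hM)
  · obtain ⟨i, hi⟩ : ∃ i, m i ≠ 2 := by
      by_contra! h
      exact h₂ ⟨rfl, rfl, h⟩
    have := Finset.sum_pos' hnonneg
      ⟨i, Finset.mem_univ i, mul_pos (by have := hm i; omega) (hpos i)⟩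
    simpa using this

end ExtGroup

/-! ### An action on the line -/

/-- The homeomorphisms of the line that act on `[0, 1]` by `x ↦ x ^ exp s` and commute with integer
translations: enough to move any point of `(0, 1)` to any other. -/
noncomputable def fractPow : Multiplicative ℝ →* CircleDeg1Lift where
  toFun s :=
    { toFun := fun x => ⌊x⌋ + Int.fract x ^ Real.exp s.toAdd
      monotone' := fun x y hxy => by
        rcases (Int.floor_mono hxy).eq_or_lt with h | h
        · have hfract : Int.fract x ≤ Int.fract y := by
            rw [Int.fract, Int.fract, h]
            exact sub_le_sub_right hxy _
          simp only [h]
          gcongr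
        · have hx : Int.fract x ^ Real.exp s.toAdd ≤ 1 :=
            Real.rpow_le_one (Int.fract_nonneg x) (Int.fract_lt_one x).le (Real.exp_nonneg _)
          have hy : 0 ≤ Int.fract y ^ Real.exp s.toAdd := Real.rpow_nonneg (Int.fract_nonneg y) _
          have hfloor : (⌊x⌋ : ℝ) + 1 ≤ ⌊y⌋ := by exact_mod_cast h
          simp only
          linarith
      map_add_one' := fun x => by
        simp only [Int.floor_add_one, Int.fract_add_one, Int.cast_add, Int.cast_one]
        ring }
  map_one' := by
    ext x
    simp
  map_mul' s t := by
    ext x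
    have h₀ : 0 ≤ Int.fract x ^ Real.exp t.toAdd := Real.rpow_nonneg (Int.fract_nonneg x) _
    have h₁ : Int.fract x ^ Real.exp t.toAdd < 1 :=
      Real.rpow_lt_one (Int.fract_nonneg x) (Int.fract_lt_one x) (Real.exp_pos _)
    rw [CircleDeg1Lift.mul_apply]
    change ⌊x⌋ + Int.fract x ^ Real.exp (s * t).toAdd =
      ⌊⌊x⌋ + Int.fract x ^ Real.exp t.toAdd⌋ +
        Int.fract (⌊x⌋ + Int.fract x ^ Real.exp t.toAdd) ^ Real.exp s.toAdd
    rw [Int.fract_intCast_add, Int.fract_eq_self.2 ⟨h₀, h₁⟩, ← Real.rpow_mul (Int.fract_nonneg x),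
      toAdd_mul, Real.exp_add, mul_comm (Real.exp s.toAdd)]
    congr 2
    exact (Int.floor_eq_iff.2 ⟨by linarith, by linarith⟩).symm

theorem exists_fractPow_eq {x y : ℝ} (hx : x ∈ Set.Ioo 0 1) (hy : y ∈ Set.Ioo 0 1) :
    ∃ s, fractPow s 0 = 0 ∧ fractPow s x = y := by
  have hpos : 0 < Real.log y / Real.log x :=
    div_pos_of_neg_of_neg (Real.log_neg hy.1 hy.2) (Real.log_neg hx.1 hx.2)
  have hpow : x ^ (Real.log y / Real.log x) = y := by
    rw [Real.rpow_def_of_pos hx.1, mul_div_cancel₀ _ (Real.log_neg hx.1 hx.2).ne,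
      Real.exp_log hy.1]
  refine ⟨.ofAdd (Real.log (Real.log y / Real.log x)), ?_, ?_⟩
  · simp [fractPow, Real.zero_rpow hpos.ne', Real.exp_log hpos]
  · simp [fractPow, Real.exp_log hpos, hpow, Int.floor_eq_zero_iff.2 ⟨hx.1.le, hx.2⟩,
      Int.fract_eq_self.2 ⟨hx.1.le, hx.2⟩]

theorem exists_circleDeg1Lift_apply_eq {x x' y y' : ℝ} (hx : x < x') (hx' : x' < x + 1)
    (hy : y < y') (hy' : y' < y + 1) : ∃ f : CircleDeg1Liftˣ, f x = y ∧ f x' = y' := by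
  obtain ⟨s, h₀, h₁⟩ := exists_fractPow_eq (x := x' - x) (y := y' - y)
    ⟨by linarith, by linarith⟩ ⟨by linarith, by linarith⟩
  refine ⟨CircleDeg1Lift.translate (.ofAdd y) * fractPow.toHomUnits s *
    CircleDeg1Lift.translate (.ofAdd (-x)), ?_, ?_⟩ <;>
    simp [h₀, h₁, ← sub_eq_neg_add]

theorem exists_circleDeg1Lift_pow_eq {r : ℕ} (hr : 2 ≤ r) {x y : ℝ} (hx : x < y) (hy : y < x + 1) :
    ∃ f : CircleDeg1Liftˣ, f ^ r = CircleDeg1Lift.translate (.ofAdd 1) ∧ f x = y := by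
  have hr' : (2 : ℝ) ≤ r := by exact_mod_cast hr
  obtain ⟨g, h₀, h₁⟩ := exists_circleDeg1Lift_apply_eq (x := 0) (x' := 1 / r) (by positivity)
    (by rw [zero_add, div_lt_one] <;> linarith) hx hy
  have hroot : CircleDeg1Lift.translate (.ofAdd (1 / (r : ℝ))) ^ r =
      CircleDeg1Lift.translate (.ofAdd 1) := by
    rw [← map_pow, ← ofAdd_nsmul, nsmul_eq_mul, mul_one_div_cancel (by positivity)]
  have hcomm : g * CircleDeg1Lift.translate (.ofAdd 1) =
      CircleDeg1Lift.translate (.ofAdd 1) * g := by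
    ext z
    simp [add_comm]
  refine ⟨g * CircleDeg1Lift.translate (.ofAdd (1 / r)) * g⁻¹, ?_, ?_⟩
  · rw [conj_pow, hroot, hcomm, mul_inv_cancel_right]
  · rw [← h₀, ← h₁]
    simp

namespace ExtGroup

variable {n k : ℕ} {m : Fin k → ℕ}

/-- The relations `eElt_mul_cutElt`, `hElt_mul_cutElt_lower` and `hElt_mul_cutElt_upper` reach every
cut from the base point. -/
@[elab_as_elim]
theorem cut_induction {Q : ℕ → Prop} (zero : Q 0) (eElt : ∀ i : Fin k, Q i → Q (i + 1))
    (lower : ∀ j : Fin (2 * n), Q (handleBlock k j) → Q (handleBlock k j + 2 + 1))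
    (upper : ∀ j : Fin (2 * n), Q (handleBlock k j + 2) → Q (handleBlock k j + 1))
    {q : ℕ} (hq : q ≤ k + 4 * n) : Q q := by
  have hk (i : ℕ) (hi : i ≤ k) : Q i := by
    induction i with
    | zero => exact zero
    | succ i ih => exact eElt ⟨i, hi⟩ (ih (by omega))
  have handle (t : Fin n) (h₀ : Q (k + 4 * t)) : Q (k + 4 * t + 1) ∧ Q (k + 4 * t + 2) ∧
      Q (k + 4 * t + 3) ∧ Q (k + 4 * (t + 1)) := by
    have lower₀ := lower (evenIndex t)
    have lower₁ := lower (oddIndex t)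
    have upper₀ := upper (evenIndex t)
    have upper₁ := upper (oddIndex t)
    rw [handleBlock_evenIndex] at lower₀ upper₀
    rw [handleBlock_oddIndex] at lower₁ upper₁
    have h₃ := lower₀ h₀
    have h₂ := upper₁ h₃
    have h₁ := upper₀ h₂
    exact ⟨h₁, h₂, h₃, lower₁ h₁⟩
  have hn (t : ℕ) (ht : t ≤ n) : Q (k + 4 * t) := by
    induction t with
    | zero => exact hk k le_rfl
    | succ t ih => exact (handle ⟨t, ht⟩ (ih (by omega))).2.2.2
  rcases le_or_gt q k with h | h
  · exact hk q h
  · obtain ⟨t, ht⟩ : ∃ t, q = k + 4 * t ∨ q = k + 4 * t + 1 ∨ q = k + 4 * t + 2 ∨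
        q = k + 4 * t + 3 := ⟨(q - k) / 4, by omega⟩
    rcases ht with rfl | rfl | rfl | rfl
    · exact hn t (by omega)
    all_goals
      obtain ⟨h₁, h₂, h₃, -⟩ := handle ⟨t, by omega⟩ (hn t (by omega))
      assumption

namespace CutSystem

variable {Ω : Type*} [LinearOrder Ω] (S : CutSystem n m 0 Ω)

theorem act_zElt_of_untwisted (p : ℤ) : S.act (zElt n k m) (S.cut p) = S.cut (p + period n k) := by
  simpa using S.act_zElt p

theorem act_zElt_zpow_of_untwisted (s p : ℤ) :
    S.act (zElt n k m ^ s) (S.cut p) = S.cut (p + period n k * s) := by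
  simpa using S.act_zElt_zpow s p

theorem act_cutElt (hm : ∀ i, m i ≠ 0) {q : ℕ} (hq : q ≤ k + 4 * n) :
    S.act (cutElt n m q) (S.cut 0) = S.cut q := by
  refine cut_induction ?_ (fun i hi => ?_) (fun j hj => ?_) (fun j hj => ?_) hq
  · simp [cutElt]
  · apply (S.act (eElt n m i)).injective
    rw [← RelIso.mul_apply, ← map_mul, eElt_mul_cutElt hm, map_mul, RelIso.mul_apply, hi,
      S.act_zElt_of_untwisted]
    simpa using (S.act_eElt i 0).symm
  · apply (S.act (hElt m j)).injective
    rw [← RelIso.mul_apply, ← map_mul, hElt_mul_cutElt_lower, map_mul, RelIso.mul_apply, hj,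
      S.act_zElt_of_untwisted]
    simpa using (S.act_hElt_lower j 0).symm
  · rw [← hElt_mul_cutElt_upper, map_mul, RelIso.mul_apply, hj]
    simpa using S.act_hElt_upper j 0

theorem lt_act_cutElt (hm : ∀ i, 2 ≤ m i) {y : Ω} (hy : S.cut (1 - period n k) < y) {q : ℕ}
    (hq : q ≤ k + 4 * n) : S.cut (q + 1 - period n k) < S.act (cutElt n m q) y ∧
      (q ≠ 0 → S.cut (q - 1) < S.act (cutElt n m q) y) := by
  have of_lt {q : ℕ} (hP : 2 ≤ period n k) (h : S.cut q < S.act (cutElt n m (q + 1)) y) :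
      S.cut ((q + 1 : ℕ) + 1 - period n k) < S.act (cutElt n m (q + 1)) y ∧
        (q + 1 ≠ 0 → S.cut ((q + 1 : ℕ) - 1) < S.act (cutElt n m (q + 1)) y) := by
    push_cast
    exact ⟨(S.cut_mono (by omega)).trans_lt h, fun _ => by rwa [add_sub_cancel_right]⟩
  refine cut_induction ?_ (fun i hi => ?_) (fun j hj => ?_) (fun j hj => ?_) hq
  · exact ⟨by simpa [cutElt] using hy, absurd rfl⟩
  · have hi' := hm i
    refine of_lt (by have := i.2; simp only [period]; omega) ?_
    rw [cutElt_succ, cutStep_of_lt, map_mul, RelIso.mul_apply]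
    have h := S.lt_act_elt (.inl ⟨i, m i - 2, by omega⟩) 0
      (by simpa [Letter.repelling, sub_eq_add_neg] using hi.1)
    have hexp : m i - 2 + 1 = m i - 1 := by omega
    simpa [Letter.attracting, Letter.shift, Letter.elt, hexp] using h
  · have hz := (S.act (zElt n k m)).strictMono hj.1
    rw [S.act_zElt_of_untwisted, sub_add_cancel, ← RelIso.mul_apply, ← map_mul,
      ← hElt_mul_cutElt_lower] at hz
    refine of_lt (by have := handleBlock_add_two_lt k j; simp only [period]; omega) ?_
    have h := S.lt_act_elt (.inr (j, false)) 1 (by simpa [Letter.repelling] using hz)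
    simpa [Letter.attracting, Letter.shift, Letter.elt] using h
  · refine of_lt (by have := handleBlock_add_two_lt k j; simp only [period]; omega) ?_
    rw [← hElt_mul_cutElt_upper, map_mul, RelIso.mul_apply]
    have h := S.lt_act_elt (.inr (j, true)) 0
      (by simpa [Letter.repelling, sub_eq_add_neg] using hj.1)
    simpa [Letter.attracting, Letter.shift, Letter.elt] using h

theorem act_cutPoint (hm : ∀ i, m i ≠ 0) (p : ℤ) :
    S.act (cutPoint n m p) (S.cut 0) = S.cut p := by
  have hlt := Int.emod_lt_of_pos p (period_pos (n := n) (k := k))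
  have hq := Int.toNat_of_nonneg (Int.emod_nonneg p (period_pos (n := n) (k := k)).ne')
  rw [cutPoint, map_mul, RelIso.mul_apply, S.act_cutElt hm (by simp only [period] at *; omega),
    S.act_zElt_zpow_of_untwisted, hq, Int.emod_add_mul_ediv]

theorem act_cutPoint_mem_Ioc (hm : ∀ i, 2 ≤ m i) {y : Ω}
    (hy : y ∈ Set.Ioc (S.cut (1 - period n k)) (S.cut 0)) {p : ℤ} (hp : p % period n k ≠ 0) :
    S.act (cutPoint n m p) y ∈ Set.Ioc (S.cut (p - 1)) (S.cut p) := by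
  have hm' (i) : m i ≠ 0 := by have := hm i; omega
  refine ⟨?_, (S.act_cutPoint hm' p).subst ((S.act _).monotone hy.2)⟩
  have hlt := Int.emod_lt_of_pos p (period_pos (n := n) (k := k))
  have hq := Int.toNat_of_nonneg (Int.emod_nonneg p (period_pos (n := n) (k := k)).ne')
  have h := (S.lt_act_cutElt hm hy.1 (q := (p % period n k).toNat)
    (by simp only [period] at *; omega)).2 (by omega)
  have := (S.act (zElt n k m ^ (p / period n k))).strictMono h
  rwa [S.act_zElt_zpow_of_untwisted, hq, sub_add_eq_add_sub, Int.emod_add_mul_ediv,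
    ← RelIso.mul_apply, ← map_mul] at this

theorem act_cuspElt_mem_Ioc (hm : ∀ i, 2 ≤ m i) (hP : 1 < period n k) {y : Ω}
    (hy : y ∈ Set.Ioc (S.cut (1 - period n k)) (S.cut 0)) :
    S.act (cuspElt n m) y ∈ Set.Ioc (S.cut (-2)) (S.cut (-1)) := by
  rw [← cutPoint_neg_one]
  refine S.act_cutPoint_mem_Ioc (p := -1) hm hy ?_
  rw [← Int.add_emod_right, Int.emod_eq_of_lt (by omega) (by omega)]
  omega

theorem act_cuspElt_pow_mem_Ioc (hm : ∀ i, 2 ≤ m i) (hP : 2 < period n k)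
    (hcut : S.cut (-1) < S.cut 0) (j : ℕ) :
    S.act (cuspElt n m ^ j) (S.cut 0) ∈ Set.Ioc (S.cut (1 - period n k)) (S.cut 0) := by
  induction j with
  | zero => simpa using (S.cut_mono (by omega)).trans_lt hcut
  | succ j ih =>
    rw [pow_succ', map_mul, RelIso.mul_apply]
    exact Set.Ioc_subset_Ioc (S.cut_mono (by omega)) (S.cut_mono (by omega))
      (S.act_cuspElt_mem_Ioc hm (by omega) ih)

end CutSystem

/-- The `p`-th cut of the line into blocks of length `1 / period n k`. -/
noncomputable def lineCut (n k : ℕ) (p : ℤ) : ℝ := p / period n k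

theorem lineCut_strictMono : StrictMono (lineCut n k) := fun p q hpq => by
  have : (0 : ℝ) < period n k := by exact_mod_cast period_pos
  have : (p : ℝ) < q := by exact_mod_cast hpq
  unfold lineCut
  gcongr

theorem lineCut_add_mul (p s : ℤ) : lineCut n k (p + period n k * s) = lineCut n k p + s := by
  have : (period n k : ℝ) ≠ 0 := by exact_mod_cast period_pos.ne'
  simp only [lineCut]
  push_cast
  field_simp

theorem lineCut_add_period (p : ℤ) : lineCut n k (p + period n k) = lineCut n k p + 1 := by
  simpa using lineCut_add_mul (n := n) (k := k) p 1

/-- An action of the group on the line by lifts of circle homeomorphisms, with the standard cuts as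
a cut system without twist. -/
structure LineAction (n : ℕ) (m : Fin k → ℕ) where
  hom : ExtGroup n k m →* CircleDeg1Liftˣ
  hom_zElt : hom (zElt n k m) = CircleDeg1Lift.translate (.ofAdd 1)
  hom_eElt i : hom (eElt n m i) (lineCut n k (i + 1)) = lineCut n k (i + period n k)
  hom_hElt_lower j : hom (hElt m j) (lineCut n k (handleBlock k j + 2 + 1)) =
    lineCut n k (handleBlock k j + period n k)
  hom_hElt_upper j : hom (hElt m j) (lineCut n k (handleBlock k j + 2)) =
    lineCut n k (handleBlock k j + 1)

theorem nonempty_lineAction (hm : ∀ i, 2 ≤ m i) : Nonempty (LineAction n m) := by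
  have lt_add_one {p q : ℤ} (h : q < p + period n k) : lineCut n k q < lineCut n k p + 1 :=
    lineCut_add_period (n := n) (k := k) p ▸ lineCut_strictMono h
  have hE (i : Fin k) : ∃ f : CircleDeg1Liftˣ, f ^ m i = CircleDeg1Lift.translate (.ofAdd 1) ∧
      f (lineCut n k (i + 1)) = lineCut n k (i + period n k) := by
    have := i.2
    exact exists_circleDeg1Lift_pow_eq (hm i)
      (lineCut_strictMono (by simp only [period]; omega)) (lt_add_one (by omega))
  have hH (j : Fin (2 * n)) : ∃ f : CircleDeg1Liftˣ,
      f (lineCut n k (handleBlock k j + 2)) = lineCut n k (handleBlock k j + 1) ∧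
      f (lineCut n k (handleBlock k j + 2 + 1)) = lineCut n k (handleBlock k j + period n k) := by
    have := handleBlock_add_two_lt k j
    refine exists_circleDeg1Lift_apply_eq (lineCut_strictMono (by omega)) (lt_add_one ?_)
      (lineCut_strictMono ?_) (lt_add_one (by omega)) <;>
    · simp only [period]
      omega
  choose E hE hE' using hE
  choose H hH hH' using hH
  refine ⟨⟨lift E H (CircleDeg1Lift.translate (.ofAdd 1)) hE fun j => ?_, lift_zElt .., ?_, ?_, ?_⟩⟩
  · ext x
    simp [add_comm]
  all_goals simpa

namespace LineAction

variable (R : LineAction n m)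

/-- The standard cuts of the line as a cut system. -/
noncomputable def cutSystem : CutSystem n m 0 ℝ where
  act := CircleDeg1Lift.toOrderIso.comp R.hom
  cut := lineCut n k
  cut_mono := lineCut_strictMono.monotone
  act_zElt p := by
    simp [lineCut_add_period, R.hom_zElt, add_comm]
  act_eElt i s := by
    simp only [MonoidHom.coe_comp, Function.comp_apply, lineCut_add_mul,
      CircleDeg1Lift.coe_toOrderIso, CircleDeg1Lift.map_add_int, R.hom_eElt, lineCut_add_period,
      zero_mul, add_zero, Int.cast_add, Int.cast_one]
    ring
  act_hElt_lower j s := by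
    simp only [MonoidHom.coe_comp, Function.comp_apply, lineCut_add_mul,
      CircleDeg1Lift.coe_toOrderIso, CircleDeg1Lift.map_add_int, R.hom_hElt_lower,
      lineCut_add_period, Int.cast_add, Int.cast_one]
    ring
  act_hElt_upper j s := by
    simp [lineCut_add_mul, R.hom_hElt_upper]

end LineAction

end ExtGroup

namespace LeftOrder

variable {Γ : Type*} [Group Γ]

theorem mul_lt_mul_left_iff (L : LeftOrder Γ) (g : Γ) {a b : Γ} :
    L.lt (g * a) (g * b) ↔ L.lt a b :=
  ⟨fun h => by simpa using L.mul_left g⁻¹ _ _ h, L.mul_left g a b⟩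

theorem ext_one_lt {L L' : LeftOrder Γ} (h : ∀ g, L.lt 1 g ↔ L'.lt 1 g) : L = L' := by
  have hlt : L.lt = L'.lt := by
    ext a b
    rw [← L.mul_lt_mul_left_iff a⁻¹, ← L'.mul_lt_mul_left_iff a⁻¹, inv_mul_cancel, h]
  cases L
  cases L'
  cases hlt
  rfl

theorem isClopen_setOf_lt (a b : Γ) : IsClopen {L : LeftOrder Γ | L.lt a b} := by
  by_cases hab : a⁻¹ * b = 1
  · rw [inv_mul_eq_one] at hab
    subst hab
    simpa only [(LeftOrder.strictTotal _).irrefl a, Set.ofPred_false] using isClopen_empty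
  · have hsign : Continuous (sign : LeftOrder Γ → _) := continuous_induced_dom
    convert (isClopen_discrete {true}).preimage
      ((continuous_apply (⟨a⁻¹ * b, hab⟩ : {g : Γ // g ≠ 1})).comp hsign) using 1
    ext L
    simp [sign, ← L.mul_lt_mul_left_iff a⁻¹ (b := b)]

/-- The left order of a group acting on a linear order, pulled back from a free orbit `f`. -/
def ofFreeOrbit {Ω : Type*} [LinearOrder Ω] (f : Γ → Ω) (hf : Function.Injective f)
    (h : ∀ g a b, f a < f b → f (g * a) < f (g * b)) : LeftOrder Γ where
  lt a b := f a < f b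
  strictTotal :=
    { trichotomous := fun _ _ h₁ h₂ => hf (le_antisymm (not_lt.1 h₂) (not_lt.1 h₁))
      irrefl := fun _ => lt_irrefl _
      trans := fun _ _ _ => lt_trans }
  mul_left := h

/-- The group as a linearly ordered set. -/
def Carrier (_L : LeftOrder Γ) : Type _ := Γ

open Classical in
noncomputable instance (L : LeftOrder Γ) : LinearOrder L.Carrier :=
  have : IsStrictTotalOrder Γ L.lt := L.strictTotal
  (linearOrderOfSTO L.lt : LinearOrder Γ)

/-- The identity map to the group as a linearly ordered set. -/
def toCarrier (L : LeftOrder Γ) : Γ ≃ L.Carrier := Equiv.refl Γ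

theorem toCarrier_lt_iff (L : LeftOrder Γ) {a b : Γ} :
    L.toCarrier a < L.toCarrier b ↔ L.lt a b := Iff.rfl

/-- The action of the group on itself by left translations, which preserve the order. -/
def mulLeft (L : LeftOrder Γ) : Γ →* L.Carrier ≃o L.Carrier where
  toFun g :=
    { toEquiv := (Equiv.mulLeft g : Equiv.Perm Γ)
      map_rel_iff' := fun {a b} => by
        rw [← not_lt, ← not_lt (a := b)]
        exact not_congr (L.mul_lt_mul_left_iff g) }
  map_one' := by
    ext a
    exact one_mul (L.toCarrier.symm a)
  map_mul' g h := by
    ext a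
    exact mul_assoc g h (L.toCarrier.symm a)

theorem mulLeft_toCarrier (L : LeftOrder Γ) (g a : Γ) :
    L.mulLeft g (L.toCarrier a) = L.toCarrier (g * a) := rfl

end LeftOrder

namespace ExtGroup

variable {n k : ℕ} {m : Fin k → ℕ} {t : ℤ}

/-! ### The isolated orders -/

/-- The twist by which the `t`-th order differs from the order coming from the line. -/
def cuspTwist (n : ℕ) (m : Fin k → ℕ) (t : ℤ) : ℤ := deg (cuspElt n m) * t

/-- The index in the group of the image of the `t`-th twist. Since it is `1` modulo the degree of
`cuspElt n m`, the powers of that element represent all cosets. -/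
def cuspIndex (n : ℕ) (m : Fin k → ℕ) (t : ℤ) : ℤ := 1 + cuspTwist n m t * ∏ i, (m i : ℤ)

/-- The least `j ≥ 0` such that `x * cuspElt n m ^ j` lies in the image of the `t`-th twist. -/
def cuspExponent (t : ℤ) (x : ExtGroup n k m) : ℤ :=
  deg x * ((∏ i, (m i : ℤ)) * t) % cuspIndex n m t

/-- The preimage of `x * cuspElt n m ^ cuspExponent t x` under the `t`-th twist. -/
def cuspShift (t : ℤ) (x : ExtGroup n k m) : ExtGroup n k m :=
  x * cuspElt n m ^ cuspExponent t x * zElt n k m ^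
    (-(cuspTwist n m t * (deg (x * cuspElt n m ^ cuspExponent t x) / cuspIndex n m t)))

theorem cuspIndex_pos (hc : 0 < deg (cuspElt n m)) (ht : 0 ≤ t) : 0 < cuspIndex n m t := by
  unfold cuspIndex cuspTwist
  positivity

theorem deg_cuspElt_mul_prod_mul :
    deg (cuspElt n m) * ((∏ i, (m i : ℤ)) * t) = cuspIndex n m t - 1 := by
  simp only [cuspIndex, cuspTwist]
  ring

theorem cuspIndex_dvd_deg (x : ExtGroup n k m) :
    cuspIndex n m t ∣ deg (x * cuspElt n m ^ cuspExponent t x) := by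
  obtain ⟨q, hq⟩ := Int.dvd_self_sub_emod
    (x := deg x * ((∏ i, (m i : ℤ)) * t)) (m := cuspIndex n m t)
  refine ⟨deg x - deg (cuspElt n m) * q, ?_⟩
  rw [deg_mul, deg_zpow, cuspExponent, ← sub_eq_zero]
  linear_combination (-deg (cuspElt n m)) * hq +
    deg x * deg_cuspElt_mul_prod_mul (n := n) (m := m) (t := t)

theorem twist_cuspShift (x : ExtGroup n k m) :
    twist n m (cuspTwist n m t) (cuspShift t x) = x * cuspElt n m ^ cuspExponent t x := by
  have hdiv := Int.mul_ediv_cancel' (cuspIndex_dvd_deg (t := t) x)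
  rw [twist_apply, cuspShift, deg_mul _ (zElt n k m ^ _), deg_zpow (zElt n k m), deg_zElt,
    mul_assoc _ (zElt n k m ^ _), ← zpow_add, mul_eq_left]
  convert zpow_zero _
  generalize deg _ / cuspIndex n m t = q at hdiv ⊢
  rw [← hdiv, cuspIndex]
  ring

theorem cuspExponent_twist_mul (g x : ExtGroup n k m) :
    cuspExponent t (twist n m (cuspTwist n m t) g * x) = cuspExponent t x := by
  rw [cuspExponent, deg_mul, deg_twist, ← cuspIndex, add_mul, mul_assoc (cuspIndex n m t),
    Int.mul_add_emod_self_left, cuspExponent]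

theorem cuspShift_twist_mul (ht : cuspIndex n m t ≠ 0) (g x : ExtGroup n k m) :
    cuspShift t (twist n m (cuspTwist n m t) g * x) = g * cuspShift t x := by
  apply twist_injective ht
  rw [map_mul, twist_cuspShift, twist_cuspShift, cuspExponent_twist_mul, mul_assoc]

theorem cuspExponent_nonneg (ht : cuspIndex n m t ≠ 0) (x : ExtGroup n k m) :
    0 ≤ cuspExponent t x :=
  Int.emod_nonneg _ ht

theorem cuspExponent_one : cuspExponent t (1 : ExtGroup n k m) = 0 := by
  simp [cuspExponent]

theorem cuspExponent_mul_cuspElt (x : ExtGroup n k m) :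
    cuspExponent t (x * cuspElt n m) = (cuspExponent t x - 1) % cuspIndex n m t := by
  rw [cuspExponent, cuspExponent, Int.emod_sub_emod, deg_mul, add_mul, deg_cuspElt_mul_prod_mul,
    ← Int.add_emod_right (_ - 1)]
  ring_nf

theorem cuspExponent_le (ht : 0 < cuspIndex n m t) (x : ExtGroup n k m) :
    cuspExponent t x ≤ cuspExponent t (x * cuspElt n m) + 1 := by
  have hx : cuspExponent t x < cuspIndex n m t := Int.emod_lt_of_pos _ ht
  rw [cuspExponent_mul_cuspElt]
  rcases eq_or_ne (cuspExponent t x) 0 with h | h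
  · rw [h]
    linarith [Int.emod_nonneg (0 - 1) ht.ne']
  · have := cuspExponent_nonneg ht.ne' x
    rw [Int.emod_eq_of_lt (by omega) (by omega), sub_add_cancel]

/-- The cut points of the `t`-th order. -/
def twistedCut (n : ℕ) (m : Fin k → ℕ) (t p : ℤ) : ExtGroup n k m := cuspShift t (cutPoint n m p)

theorem twistedCut_zero : twistedCut n m t 0 = 1 := by
  simp [twistedCut, cutPoint_zero, cuspShift, cuspExponent_one]

theorem twist_twistedCut_neg_one (ht : 0 < cuspIndex n m t) :
    twist n m (cuspTwist n m t) (twistedCut n m t (-1)) = cuspElt n m ^ cuspIndex n m t := by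
  have hexp : cuspExponent t (cuspElt n m) = cuspIndex n m t - 1 := by
    have h := cuspExponent_mul_cuspElt (t := t) (1 : ExtGroup n k m)
    rw [one_mul, cuspExponent_one, ← Int.add_emod_right, Int.emod_eq_of_lt (by omega) (by omega)]
      at h
    omega
  rw [twistedCut, cutPoint_neg_one, twist_cuspShift, hexp, mul_self_zpow, sub_add_cancel]

theorem mul_twistedCut (ht : cuspIndex n m t ≠ 0) {g : ExtGroup n k m} {p p' : ℤ}
    (h : g * cutPoint n m p = cutPoint n m p') : g * twistedCut n m t p =
      twistedCut n m t (p' + period n k * (cuspTwist n m t * deg g)) := by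
  rw [twistedCut, ← cuspShift_twist_mul ht, twist_apply, (zElt_zpow_commute _ g).symm.eq,
    mul_assoc, h, ← cutPoint_add_mul, twistedCut]

theorem zElt_zpow_mul_twistedCut (ht : cuspIndex n m t ≠ 0) (s p : ℤ) :
    zElt n k m ^ s * twistedCut n m t p =
      twistedCut n m t (p + period n k * cuspIndex n m t * s) := by
  rw [mul_twistedCut ht (cutPoint_add_mul p s).symm, deg_zpow, deg_zElt, cuspIndex]
  ring_nf

/-- A left order in which the cut points `twistedCut n m t` increase weakly. -/
structure IsCuspOrder (t : ℤ) (L : LeftOrder (ExtGroup n k m)) : Prop where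
  neg : L.lt (twistedCut n m t (-1)) 1
  mono : ∀ p, ¬ L.lt (twistedCut n m t (p + 1)) (twistedCut n m t p)

theorem isCuspOrder_iff (ht : 0 < cuspIndex n m t) (L : LeftOrder (ExtGroup n k m)) :
    IsCuspOrder t L ↔ L.lt (twistedCut n m t (-1)) 1 ∧
      ∀ p ∈ Finset.Ico 0 (period n k * cuspIndex n m t),
        ¬ L.lt (twistedCut n m t (p + 1)) (twistedCut n m t p) := by
  refine ⟨fun h => ⟨h.neg, fun p _ => h.mono p⟩, fun h => ⟨h.1, fun p => ?_⟩⟩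
  have hpos := mul_pos (period_pos (n := n) (k := k)) ht
  set N := period n k * cuspIndex n m t
  have hp := h.2 (p % N)
    (Finset.mem_Ico.2 ⟨Int.emod_nonneg p hpos.ne', Int.emod_lt_of_pos p hpos⟩)
  rwa [← L.mul_lt_mul_left_iff (zElt n k m ^ (p / N)), zElt_zpow_mul_twistedCut ht.ne',
    zElt_zpow_mul_twistedCut ht.ne', add_right_comm, Int.emod_add_mul_ediv] at hp

theorem isOpen_setOf_isCuspOrder (ht : 0 < cuspIndex n m t) :
    IsOpen {L : LeftOrder (ExtGroup n k m) | IsCuspOrder t L} := by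
  simp only [isCuspOrder_iff ht, Set.ofPred_and, Set.ofPred_forall]
  exact (LeftOrder.isClopen_setOf_lt _ _).isOpen.inter
    (isOpen_biInter_finset fun p _ => (LeftOrder.isClopen_setOf_lt _ _).compl.isOpen)

namespace IsCuspOrder

variable {L L' : LeftOrder (ExtGroup n k m)}

/-- The cut system of the left translations of the group ordered by `L`. -/
def cutSystem (hL : IsCuspOrder t L) (ht : cuspIndex n m t ≠ 0) (hm : ∀ i, m i ≠ 0) :
    CutSystem n m (cuspTwist n m t) L.Carrier where
  act := L.mulLeft
  cut p := L.toCarrier (twistedCut n m t p)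
  cut_mono := monotone_int_of_le_succ fun p => not_lt.1 (hL.mono p)
  act_zElt p := by
    rw [L.mulLeft_toCarrier, mul_twistedCut ht (zElt_mul_cutPoint p), deg_zElt]
    ring_nf
  act_eElt i s := by
    rw [L.mulLeft_toCarrier, mul_twistedCut ht (eElt_mul_cutPoint hm i s)]
    ring_nf
  act_hElt_lower j s := by
    rw [L.mulLeft_toCarrier, mul_twistedCut ht (hElt_mul_cutPoint_lower j s), deg_hElt]
    ring_nf
  act_hElt_upper j s := by
    rw [L.mulLeft_toCarrier, mul_twistedCut ht (hElt_mul_cutPoint_upper j s), deg_hElt]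
    ring_nf

theorem cutSystem_cut_zero (hL : IsCuspOrder t L) (ht : cuspIndex n m t ≠ 0)
    (hm : ∀ i, m i ≠ 0) : (hL.cutSystem ht hm).cut 0 = L.toCarrier 1 :=
  congrArg L.toCarrier twistedCut_zero

theorem cutSystem_cut_neg_one_lt (hL : IsCuspOrder t L) (ht : cuspIndex n m t ≠ 0)
    (hm : ∀ i, m i ≠ 0) : (hL.cutSystem ht hm).cut (-1) < (hL.cutSystem ht hm).cut 0 := by
  rw [cutSystem_cut_zero]
  exact hL.neg

theorem cutSystem_act_one (hL : IsCuspOrder t L) (ht : cuspIndex n m t ≠ 0)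
    (hm : ∀ i, m i ≠ 0) (g : ExtGroup n k m) :
    (hL.cutSystem ht hm).act g (L.toCarrier 1) = L.toCarrier g :=
  congrArg L.toCarrier (mul_one g)

theorem unique (hL : IsCuspOrder t L) (hL' : IsCuspOrder t L') (ht : cuspIndex n m t ≠ 0)
    (hm : ∀ i, 2 ≤ m i) : L = L' := by
  have hm' (i) : m i ≠ 0 := by have := hm i; omega
  refine LeftOrder.ext_one_lt fun g => ?_
  have h := (hL.cutSystem ht hm').lt_act_iff_lt_act (hL'.cutSystem ht hm')
    (hL.cutSystem_cut_neg_one_lt ht hm') (hL'.cutSystem_cut_neg_one_lt ht hm') hm g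
  simpa only [cutSystem_cut_zero, cutSystem_act_one, LeftOrder.toCarrier_lt_iff] using h

theorem isIsolated (hL : IsCuspOrder t L) (ht : 0 < cuspIndex n m t) (hm : ∀ i, 2 ≤ m i) :
    L.IsIsolated := by
  have h : {L} = {L : LeftOrder (ExtGroup n k m) | IsCuspOrder t L} :=
    Set.Subset.antisymm (Set.singleton_subset_iff.2 hL) fun L' hL' => hL'.unique hL ht.ne' hm
  rw [LeftOrder.IsIsolated, h]
  exact isOpen_setOf_isCuspOrder ht

theorem not_lt_of_lt_one (hL : IsCuspOrder t L) (ht : cuspIndex n m t ≠ 0) (hm : ∀ i, 2 ≤ m i)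
    {g : ExtGroup n k m} (hg : L.lt g 1) : ¬ L.lt (twistedCut n m t (-1)) g := by
  have hm' (i) : m i ≠ 0 := by have := hm i; omega
  intro h
  have hone : g = 1 := by
    refine (hL.cutSystem ht hm').eq_one_of_act_mem_Ioc (hL.cutSystem_cut_neg_one_lt ht hm') hm ht ?_
    rw [cutSystem_cut_zero, cutSystem_act_one]
    exact ⟨h, (L.toCarrier_lt_iff.2 hg).le⟩
  exact L.strictTotal.irrefl 1 (hone ▸ hg)

theorem apply_twistedCut_neg_one {t' : ℤ} {φ : ExtGroup n k m ≃* ExtGroup n k m}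
    (hL : IsCuspOrder t (L'.autImage φ)) (hL' : IsCuspOrder t' L') (ht : cuspIndex n m t ≠ 0)
    (ht' : cuspIndex n m t' ≠ 0) (hm : ∀ i, 2 ≤ m i) :
    φ (twistedCut n m t (-1)) = twistedCut n m t' (-1) := by
  refine L'.strictTotal.trichotomous _ _ ?_ (hL'.not_lt_of_lt_one ht' hm ?_)
  · have h := hL.not_lt_of_lt_one ht hm (g := φ.symm (twistedCut n m t' (-1)))
    simp only [LeftOrder.autImage, map_one, MulEquiv.apply_symm_apply] at h
    exact h hL'.neg
  · simpa only [LeftOrder.autImage, map_one] using hL.neg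

end IsCuspOrder

namespace CutSystem

variable {Ω : Type*} [LinearOrder Ω] (S : CutSystem n m 0 Ω)

theorem antitone_act_mul_cuspElt_zpow (hm : ∀ i, m i ≠ 0) (x : ExtGroup n k m) :
    Antitone fun j : ℤ => S.act (x * cuspElt n m ^ j) (S.cut 0) := by
  refine antitone_int_of_succ_le fun j => ?_
  rw [zpow_add_one, ← mul_assoc, map_mul, RelIso.mul_apply]
  refine (S.act _).monotone ?_
  rw [← cutPoint_neg_one, S.act_cutPoint hm]
  exact S.cut_mono (by omega)

/-- The order of the orbit of `S.cut 0` under the action twisted by `r`. -/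
def twistedOrder {r : ℤ} (hr : 1 + r * ∏ i, (m i : ℤ) ≠ 0) (hm : ∀ i, 2 ≤ m i)
    (hcut : S.cut (-1) < S.cut 0) : LeftOrder (ExtGroup n k m) :=
  .ofFreeOrbit (fun g => S.act (twist n m r g) (S.cut 0))
    (fun a b hab => by
      rw [← inv_mul_eq_one]
      apply twist_injective hr
      rw [map_one]
      refine S.eq_one_of_act_mem_Ioc hcut hm (by simp) ?_
      rw [map_mul, map_inv, map_mul, RelIso.mul_apply, (S.act_inv_eq_iff _).2 hab.symm]
      exact ⟨hcut, le_rfl⟩)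
    (fun g a b hab => by
      simpa only [map_mul, RelIso.mul_apply] using (S.act (twist n m r g)).strictMono hab)

theorem isCuspOrder_twistedOrder (ht : 0 < cuspIndex n m t) (hm : ∀ i, 2 ≤ m i)
    (hcut : S.cut (-1) < S.cut 0) (hP : 2 < period n k) :
    IsCuspOrder t (S.twistedOrder (r := cuspTwist n m t) ht.ne' hm hcut) := by
  have hm' (i) : m i ≠ 0 := by have := hm i; omega
  have pow_mem (x : ExtGroup n k m) : S.act (cuspElt n m ^ cuspExponent t x) (S.cut 0) ∈
      Set.Ioc (S.cut (1 - period n k)) (S.cut 0) := by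
    lift cuspExponent t x to ℕ using cuspExponent_nonneg ht.ne' x with j
    exact_mod_cast S.act_cuspElt_pow_mem_Ioc hm hP hcut j
  refine ⟨?_, fun p => not_lt.2 ?_⟩
  · change S.act (twist n m (cuspTwist n m t) (cuspShift t _)) (S.cut 0) <
      S.act (twist n m (cuspTwist n m t) 1) (S.cut 0)
    rw [twist_cuspShift, cutPoint_neg_one, map_mul, RelIso.mul_apply, map_one, map_one,
      RelIso.one_apply]
    exact ((S.act_cuspElt_mem_Ioc hm (by omega) (pow_mem _)).2).trans_lt hcut
  change S.act (twist n m (cuspTwist n m t) (cuspShift t _)) (S.cut 0) ≤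
    S.act (twist n m (cuspTwist n m t) (cuspShift t _)) (S.cut 0)
  rw [twist_cuspShift, twist_cuspShift]
  by_cases hp : (p + 1) % period n k = 0
  · obtain ⟨s, hs⟩ := Int.dvd_of_emod_eq_zero hp
    have hsucc : cutPoint n m (p + 1) = zElt n k m ^ s := by
      rw [hs, ← zero_add (_ * s), cutPoint_add_mul, cutPoint_zero, mul_one]
    have hself : cutPoint n m p = zElt n k m ^ s * cuspElt n m := by
      rw [← cutPoint_neg_one, ← cutPoint_add_mul, ← hs]
      congr 1
      ring
    rw [hsucc, hself, mul_assoc, mul_self_zpow]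
    exact S.antitone_act_mul_cuspElt_zpow hm' _ (cuspExponent_le ht _)
  · calc
      _ ≤ S.act (cutPoint n m p * cuspElt n m ^ (0 : ℤ)) (S.cut 0) :=
        S.antitone_act_mul_cuspElt_zpow hm' _ (cuspExponent_nonneg ht.ne' _)
      _ = S.cut p := by rw [zpow_zero, mul_one, S.act_cutPoint hm']
      _ = S.cut (p + 1 - 1) := by rw [add_sub_cancel_right]
      _ ≤ _ := by
        rw [map_mul, RelIso.mul_apply]
        exact (S.act_cutPoint_mem_Ioc hm (pow_mem _) hp).1.le

end CutSystem

end ExtGroup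

/-! ### Homogeneous quasimorphisms -/

theorem eq_zero_of_forall_natCast_mul_abs_le {x C : ℝ} (h : ∀ N : ℕ, N * |x| ≤ C) : x = 0 := by
  by_contra hx
  obtain ⟨N, hN⟩ := exists_lt_nsmul (abs_pos.2 hx) C
  exact (h N).not_gt (by rwa [← nsmul_eq_mul])

/-- A homogeneous quasimorphism of defect at most `C`. -/
structure IsHomogeneousQuasimorphism {G : Type*} [Group G] (C : ℝ) (f : G → ℝ) : Prop where
  abs_map_mul_sub_le : ∀ g h, |f (g * h) - f g - f h| ≤ C
  map_pow : ∀ g (N : ℕ), f (g ^ N) = N * f g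

namespace IsHomogeneousQuasimorphism

variable {G : Type*} [Group G] {C : ℝ} {f : G → ℝ} (hf : IsHomogeneousQuasimorphism C f)

include hf

theorem map_mul_of_commute {g h : G} (hgh : Commute g h) : f (g * h) = f g + f h := by
  rw [← sub_eq_zero, ← sub_sub]
  refine eq_zero_of_forall_natCast_mul_abs_le (C := C) fun N => ?_
  rw [← Nat.abs_cast N, ← abs_mul, mul_sub, mul_sub, ← hf.map_pow, ← hf.map_pow, ← hf.map_pow,
    hgh.mul_pow]
  exact hf.abs_map_mul_sub_le _ _

theorem map_one : f 1 = 0 := by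
  simpa using hf.map_pow 1 0

theorem map_inv (g : G) : f g⁻¹ = -f g := by
  rw [eq_neg_iff_add_eq_zero, ← hf.map_mul_of_commute (Commute.refl g).inv_left, inv_mul_cancel,
    hf.map_one]

theorem map_zpow (g : G) (s : ℤ) : f (g ^ s) = s * f g := by
  cases s with
  | ofNat N => simpa using hf.map_pow g N
  | negSucc N => rw [zpow_negSucc, hf.map_inv, hf.map_pow, Int.cast_negSucc, neg_mul]

theorem map_conj (g h : G) : f (g * h * g⁻¹) = f h := by
  rw [← sub_eq_zero]
  refine eq_zero_of_forall_natCast_mul_abs_le (C := C + C) fun N => ?_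
  rw [← Nat.abs_cast N, ← abs_mul, mul_sub, ← hf.map_pow, ← hf.map_pow, conj_pow]
  have h₁ := hf.abs_map_mul_sub_le (g * h ^ N) g⁻¹
  have h₂ := hf.abs_map_mul_sub_le g (h ^ N)
  rw [hf.map_inv] at h₁
  rw [abs_le] at *
  constructor <;> linarith

theorem abs_map_mul_le (g h : G) : |f (g * h)| ≤ |f g| + |f h| + C := by
  have htri := abs_add_three (f (g * h) - f g - f h) (f g) (f h)
  rw [sub_sub, add_assoc, sub_add_cancel, ← sub_sub] at htri
  linarith [hf.abs_map_mul_sub_le g h]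

theorem abs_map_commutator_le (g h : G) : |f (g * h * g⁻¹ * h⁻¹)| ≤ C := by
  simpa [hf.map_conj, hf.map_inv] using hf.abs_map_mul_sub_le (g * h * g⁻¹) h⁻¹

theorem comp {H : Type*} [Group H] (φ : H →* G) : IsHomogeneousQuasimorphism C (f ∘ φ) where
  abs_map_mul_sub_le g h := by simpa using hf.abs_map_mul_sub_le (φ g) (φ h)
  map_pow g N := by simpa using hf.map_pow (φ g) N

end IsHomogeneousQuasimorphism

namespace ExtGroup

variable {n k : ℕ} {m : Fin k → ℕ}

theorem level_emod_eq (hm : ∀ i, 2 ≤ m i) {l l' : List (Letter n m)} (hl : Reduced l)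
    (hl' : Reduced l') {s s' : ℤ} (h : wordElt l * zElt n k m ^ s = wordElt l' * zElt n k m ^ s') :
    level 0 l % period n k = level 0 l' % period n k := by
  obtain ⟨R⟩ := nonempty_lineAction (n := n) hm
  have hcut : R.cutSystem.cut (-1) < R.cutSystem.cut 0 := lineCut_strictMono (by omega)
  have h₁ := R.cutSystem.act_wordElt_mul_zpow_mem_Ioc hl s hcut
  have h₂ := R.cutSystem.act_wordElt_mul_zpow_mem_Ioc hl' s' hcut
  rw [h] at h₁
  have hlt := lineCut_strictMono.lt_iff_lt.1 (h₁.1.trans_le h₂.2)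
  have hgt := lineCut_strictMono.lt_iff_lt.1 (h₂.1.trans_le h₁.2)
  have hlevel := congrArg (· % period n k)
    (le_antisymm (Int.lt_add_one_iff.1 hlt) (Int.lt_add_one_iff.1 hgt))
  simpa only [mul_assoc, Int.add_mul_emod_self_left] using hlevel

theorem center_le_zpowers_zElt (hk : 1 ≤ k) (hm : ∀ i, 2 ≤ m i) (hK : 2 ≤ k + 4 * n) :
    Subgroup.center (ExtGroup n k m) ≤ Subgroup.zpowers (zElt n k m) := by
  intro w hw
  obtain ⟨l, s, hl, rfl⟩ := exists_reduced hm w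
  rcases l with _ | ⟨a, l⟩
  · exact ⟨s, by simp⟩
  exfalso
  -- the products of `w` with `b` on the two sides move the base point to different blocks
  obtain ⟨b, hattracting, hrepelling⟩ := Letter.exists_avoiding hk hm hK a.attracting
  obtain ⟨l', s', hl', hmul, hhead⟩ := exists_reduced_mul_elt b a l hl
  have hcomm : wordElt (b :: a :: l) * zElt n k m ^ s = wordElt l' * zElt n k m ^ (s' + s) := by
    rw [zpow_add, ← mul_assoc, ← hmul, wordElt_cons b, mul_assoc, Subgroup.mem_center_iff.1 hw,
      mul_assoc, (zElt_zpow_commute s _).eq, mul_assoc]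
  have hlevel := level_emod_eq hm (List.isChain_cons_cons.2 ⟨hrepelling, hl⟩) hl' hcomm
  have hb := b.attracting_cast_lt
  rw [level_cons_emod] at hlevel
  rcases l' with _ | ⟨d, l'⟩
  · rw [level, ← Int.add_emod_right, Int.emod_eq_of_lt (by omega) (by omega)] at hlevel
    omega
  · rw [level_cons_emod, hhead d rfl] at hlevel
    exact hattracting (by exact_mod_cast hlevel)

end ExtGroup

theorem abs_translationNumber_add_sub_mul_le (f g : CircleDeg1Lift) :
    |f.translationNumber + g.translationNumber - (f * g).translationNumber| ≤ 4 := by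
  have hmul := CircleDeg1Lift.dist_map_map_zero_lt f g
  have hf := f.dist_map_zero_translationNumber_le
  have hg := g.dist_map_zero_translationNumber_le
  have hfg := (f * g).dist_map_zero_translationNumber_le
  rw [CircleDeg1Lift.mul_apply] at hfg
  rw [Real.dist_eq, abs_le] at hf hg hfg
  rw [Real.dist_eq, abs_lt] at hmul
  rw [abs_le]
  constructor <;> linarith

namespace ExtGroup

variable {n k : ℕ} {m : Fin k → ℕ}

namespace LineAction

variable (R : LineAction n m)

/-- The homogeneous quasimorphism obtained from the translation number by subtracting it from the
degree, scaled so as to vanish at `z`. -/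
noncomputable def reducedDeg (g : ExtGroup n k m) : ℝ :=
  deg g - (∏ i, (m i : ℝ)) * (R.hom g : CircleDeg1Lift).translationNumber

theorem isHomogeneousQuasimorphism_reducedDeg :
    IsHomogeneousQuasimorphism ((∏ i, (m i : ℝ)) * 4) R.reducedDeg where
  abs_map_mul_sub_le g h := by
    have hdefect : R.reducedDeg (g * h) - R.reducedDeg g - R.reducedDeg h = (∏ i, (m i : ℝ)) *
        ((R.hom g : CircleDeg1Lift).translationNumber + (R.hom h : CircleDeg1Lift).translationNumber
          - (R.hom g * R.hom h : CircleDeg1Lift).translationNumber) := by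
      simp only [reducedDeg, deg_mul, map_mul, Units.val_mul]
      push_cast
      ring
    rw [hdefect, abs_mul, abs_of_nonneg (by positivity)]
    gcongr
    exact abs_translationNumber_add_sub_mul_le _ _
  map_pow g N := by
    simp only [reducedDeg, deg_pow, map_pow, Units.val_pow_eq_pow_val,
      CircleDeg1Lift.translationNumber_pow]
    push_cast
    ring

theorem reducedDeg_zElt : R.reducedDeg (zElt n k m) = 0 := by
  simp [reducedDeg, R.hom_zElt, CircleDeg1Lift.translationNumber_translate]

theorem translationNumber_cuspElt (hm : ∀ i, 2 ≤ m i) (hP : 2 < period n k) :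
    (R.hom (cuspElt n m) : CircleDeg1Lift).translationNumber = 0 := by
  refine eq_zero_of_forall_natCast_mul_abs_le (C := 2) fun N => ?_
  have h₁ : R.hom (cuspElt n m ^ N) (lineCut n k 0) ∈
      Set.Ioc (lineCut n k (1 - period n k)) (lineCut n k 0) :=
    R.cutSystem.act_cuspElt_pow_mem_Ioc hm hP (lineCut_strictMono (by omega)) N
  have h₂ := (R.hom (cuspElt n m ^ N) : CircleDeg1Lift).dist_map_zero_translationNumber_le
  have h₃ : lineCut n k (-period n k) < lineCut n k (1 - period n k) :=
    lineCut_strictMono (by omega)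
  have hzero : lineCut n k 0 = 0 := by simp [lineCut]
  have hone := lineCut_add_period (n := n) (k := k) (-period n k)
  rw [neg_add_cancel, hzero] at hone
  rw [hzero] at h₁
  rw [← Nat.abs_cast N, ← abs_mul, ← CircleDeg1Lift.translationNumber_pow,
    ← Units.val_pow_eq_pow_val, ← map_pow]
  rw [Real.dist_eq, abs_le] at h₂
  rw [abs_le]
  constructor <;> linarith [h₁.1, h₁.2]

theorem reducedDeg_cuspElt (hm : ∀ i, 2 ≤ m i) (hP : 2 < period n k) :
    R.reducedDeg (cuspElt n m) = deg (cuspElt n m) := by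
  rw [reducedDeg, R.translationNumber_cuspElt hm hP, mul_zero, sub_zero]

end LineAction

section Bound

variable {C : ℝ} {f : ExtGroup n k m → ℝ} (hf : IsHomogeneousQuasimorphism C f)
  (hz : f (zElt n k m) = 0)

include hf hz

theorem map_zElt_zpow_mul (s : ℤ) (g : ExtGroup n k m) : f (zElt n k m ^ s * g) = f g := by
  rw [hf.map_mul_of_commute (zElt_zpow_commute s g), hf.map_zpow, hz, mul_zero, zero_add]

theorem map_eElt (hm : ∀ i, m i ≠ 0) (i : Fin k) : f (eElt n m i) = 0 := by
  have h := hf.map_pow (eElt n m i) (m i)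
  rw [eElt_pow, hz, eq_comm] at h
  exact (mul_eq_zero.1 h).resolve_left (Nat.cast_ne_zero.2 (hm i))

theorem abs_map_cutElt_le (hm : ∀ i, m i ≠ 0) {q : ℕ} (hq : q ≤ k) :
    |f (cutElt n m q)| ≤ q * C := by
  induction q with
  | zero => simp [cutElt, hf.map_one]
  | succ q ih =>
    have h := hf.abs_map_mul_le (cutStep n m q) (cutElt n m q)
    have hstep : f (cutStep n m q) = 0 := by
      rw [cutStep_of_lt ⟨q, hq⟩, hf.map_pow, map_eElt hf hz hm, mul_zero]
    rw [hstep, abs_zero] at h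
    rw [cutElt_succ]
    push_cast
    linarith [ih (by omega)]

theorem abs_map_cutElt_handle_le (hm : ∀ i, m i ≠ 0) {t : ℕ} (ht : t ≤ n) :
    |f (cutElt n m (k + 4 * t))| ≤ (k + 2 * t) * C := by
  induction t with
  | zero => simpa using abs_map_cutElt_le hf hz hm le_rfl
  | succ t ih =>
    set a := hElt m (evenIndex ⟨t, ht⟩)
    set b := hElt m (oddIndex ⟨t, ht⟩)
    have hstep : cutElt n m (k + 4 * (t + 1)) =
        zElt n k m ^ (2 : ℤ) * (b⁻¹ * a * b⁻¹⁻¹ * a⁻¹ * cutElt n m (k + 4 * t)) := by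
      obtain ⟨h₀, h₁, h₂, h₃⟩ := cutElt_handle_steps (m := m) ⟨t, ht⟩
      rw [h₃, h₂, h₁, h₀]
      simp [handleStep, mul_assoc, pow_two, (zElt_commute b⁻¹).symm.left_comm, a, b]
    have hmul := hf.abs_map_mul_le (b⁻¹ * a * b⁻¹⁻¹ * a⁻¹) (cutElt n m (k + 4 * t))
    have hcommutator := hf.abs_map_commutator_le b⁻¹ a
    rw [hstep, map_zElt_zpow_mul hf hz]
    push_cast
    linarith [ih (by omega)]

theorem abs_map_cuspElt_le (hm : ∀ i, m i ≠ 0) : |f (cuspElt n m)| ≤ (k + 2 * n) * C := by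
  rw [cuspElt, ← zpow_neg_one, map_zElt_zpow_mul hf hz]
  exact abs_map_cutElt_handle_le hf hz hm le_rfl

end Bound

/-- The homogeneous quasimorphisms that vanish at `z` and have at most the defect bounding that of
`LineAction.reducedDeg`. -/
def reducedQuasimorphisms (n : ℕ) (m : Fin k → ℕ) : Set (ExtGroup n k m → ℝ) :=
  {f | IsHomogeneousQuasimorphism ((∏ i, (m i : ℝ)) * 4) f ∧ f (zElt n k m) = 0}

/-- The largest absolute value at `g` of a function in `reducedQuasimorphisms n m`. In the spirit of
Bavard duality, it measures the stable commutator length of `g` modulo `z`. -/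
noncomputable def reducedNorm (g : ExtGroup n k m) : ℝ :=
  ⨆ f : reducedQuasimorphisms n m, |f.1 g|

theorem reducedNorm_zpow (g : ExtGroup n k m) {N : ℤ} (hN : 0 ≤ N) :
    reducedNorm (g ^ N) = N * reducedNorm g := by
  have hN' : (0 : ℝ) ≤ N := Int.cast_nonneg hN
  rw [reducedNorm, reducedNorm, Real.mul_iSup_of_nonneg hN']
  exact iSup_congr fun f => by rw [f.2.1.map_zpow, abs_mul, abs_of_nonneg hN']

theorem reducedNorm_twist (r : ℤ) (g : ExtGroup n k m) :
    reducedNorm (twist n m r g) = reducedNorm g :=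
  iSup_congr fun f => by
    rw [twist_apply, (zElt_zpow_commute _ g).symm.eq, map_zElt_zpow_mul f.2.1 f.2.2]

theorem comp_mem_reducedQuasimorphisms (hk : 1 ≤ k) (hm : ∀ i, 2 ≤ m i) (hK : 2 ≤ k + 4 * n)
    (φ : ExtGroup n k m ≃* ExtGroup n k m) {f : ExtGroup n k m → ℝ}
    (hf : f ∈ reducedQuasimorphisms n m) : f ∘ φ ∈ reducedQuasimorphisms n m := by
  refine ⟨hf.1.comp φ.toMonoidHom, ?_⟩
  have hcenter : φ (zElt n k m) ∈ Subgroup.center (ExtGroup n k m) :=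
    MulEquivClass.apply_mem_center φ (zpowers_zElt_le_center (Subgroup.mem_zpowers _))
  obtain ⟨s, hs : zElt n k m ^ s = φ (zElt n k m)⟩ := center_le_zpowers_zElt hk hm hK hcenter
  rw [Function.comp_apply, ← hs, hf.1.map_zpow, hf.2, mul_zero]

theorem reducedNorm_map (hk : 1 ≤ k) (hm : ∀ i, 2 ≤ m i) (hK : 2 ≤ k + 4 * n)
    (φ : ExtGroup n k m ≃* ExtGroup n k m) (g : ExtGroup n k m) :
    reducedNorm (φ g) = reducedNorm g := by
  refine Function.Surjective.iSup_congr
    (fun f => ⟨f.1 ∘ φ, comp_mem_reducedQuasimorphisms hk hm hK φ f.2⟩) (fun f => ?_) fun _ => rfl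
  refine ⟨⟨f.1 ∘ φ.symm, comp_mem_reducedQuasimorphisms hk hm hK φ.symm f.2⟩, Subtype.ext ?_⟩
  ext x
  simp

theorem reducedNorm_cuspElt_pos (hm : ∀ i, 2 ≤ m i) (hP : 2 < period n k)
    (hc : 0 < deg (cuspElt n m)) : 0 < reducedNorm (cuspElt n m) := by
  have hm' (i) : m i ≠ 0 := by have := hm i; omega
  obtain ⟨R⟩ := nonempty_lineAction (n := n) hm
  have hbdd : BddAbove (Set.range fun f : reducedQuasimorphisms n m => |f.1 (cuspElt n m)|) :=
    ⟨_, Set.forall_mem_range.2 fun f => abs_map_cuspElt_le f.2.1 f.2.2 hm'⟩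
  have hle : |R.reducedDeg (cuspElt n m)| ≤ reducedNorm (cuspElt n m) :=
    le_ciSup hbdd ⟨_, R.isHomogeneousQuasimorphism_reducedDeg, R.reducedDeg_zElt⟩
  rw [R.reducedDeg_cuspElt hm hP] at hle
  exact (abs_pos.2 (Int.cast_ne_zero.2 hc.ne')).trans_le hle

theorem reducedNorm_twistedCut_neg_one {t : ℤ} (ht : 0 < cuspIndex n m t) :
    reducedNorm (twistedCut n m t (-1)) = cuspIndex n m t * reducedNorm (cuspElt n m) := by
  rw [← reducedNorm_twist (cuspTwist n m t), twist_twistedCut_neg_one ht, reducedNorm_zpow _ ht.le]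

theorem cuspIndex_injective (hm : ∀ i, m i ≠ 0) (hc : 0 < deg (cuspElt n m)) :
    Function.Injective (cuspIndex n m) := by
  have hM : ∏ i, (m i : ℤ) ≠ 0 := Finset.prod_ne_zero_iff.2 fun i _ => by exact_mod_cast hm i
  intro t t' h
  simpa [cuspIndex, cuspTwist, hM, hc.ne'] using h

theorem IsCuspOrder.eq_of_autImage {t t' : ℤ} {L : LeftOrder (ExtGroup n k m)}
    {φ : ExtGroup n k m ≃* ExtGroup n k m} (hL : IsCuspOrder t (L.autImage φ))
    (hL' : IsCuspOrder t' L) (ht : 0 ≤ t) (ht' : 0 ≤ t') (hk : 1 ≤ k) (hm : ∀ i, 2 ≤ m i)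
    (hP : 2 < period n k) (hc : 0 < deg (cuspElt n m)) : t = t' := by
  have hK : 2 ≤ k + 4 * n := by simp only [period] at hP; omega
  have hD := cuspIndex_pos hc ht
  have hD' := cuspIndex_pos hc ht'
  have hnorm := reducedNorm_map hk hm hK φ (twistedCut n m t (-1))
  rw [hL.apply_twistedCut_neg_one hL' hD.ne' hD'.ne' hm, reducedNorm_twistedCut_neg_one hD',
    reducedNorm_twistedCut_neg_one hD] at hnorm
  have hindex := mul_right_cancel₀ (reducedNorm_cuspElt_pos hm hP hc).ne' hnorm
  have hm' (i) : m i ≠ 0 := by have := hm i; omega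
  exact (cuspIndex_injective hm' hc (Int.cast_injective hindex)).symm

theorem exists_isCuspOrder (hm : ∀ i, 2 ≤ m i) (hP : 2 < period n k) {t : ℤ}
    (ht : 0 < cuspIndex n m t) : ∃ L : LeftOrder (ExtGroup n k m), IsCuspOrder t L := by
  obtain ⟨R⟩ := nonempty_lineAction (n := n) hm
  exact ⟨_, R.cutSystem.isCuspOrder_twistedOrder ht hm (lineCut_strictMono (by omega)) hP⟩

end ExtGroup

theorem theorem1p2 (n k : ℕ) (m : Fin k → ℕ) (hk : 1 ≤ k) (hm : ∀ i, 2 ≤ m i)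
    (h₁ : ¬ (n = 0 ∧ k = 1))
    (h₂ : ¬ (n = 0 ∧ k = 2 ∧ ∀ i, m i = 2)) :
    -- the group is a central extension of the free product by the infinite cyclic group `⟨z⟩`
    (¬ IsOfFinOrder (ExtGroup.zElt n k m) ∧
      Subgroup.zpowers (ExtGroup.zElt n k m) ≤ Subgroup.center (ExtGroup n k m) ∧
      ∃ π : ExtGroup n k m →* FreeProdCyclic n k m,
        Function.Surjective π ∧ π.ker = Subgroup.zpowers (ExtGroup.zElt n k m)) ∧
    -- a countably infinite family of isolated left orders, none an automorphic image of another
    ∃ L : ℕ → LeftOrder (ExtGroup n k m),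
      (∀ i, (L i).IsIsolated) ∧
      ∀ i j, i ≠ j → ∀ φ : ExtGroup n k m ≃* ExtGroup n k m, L i ≠ (L j).autImage φ := by
  have hP : 2 < ExtGroup.period n k := by simp only [ExtGroup.period]; omega
  have hc := ExtGroup.deg_cuspElt_pos hk hm h₁ h₂
  have hindex (t : ℕ) := ExtGroup.cuspIndex_pos hc t.cast_nonneg
  have hz := ExtGroup.not_isOfFinOrder_zElt (n := n) fun i => (two_pos.trans_le (hm i)).ne'
  refine ⟨⟨hz, ExtGroup.zpowers_zElt_le_center, ExtGroup.toFreeProd n m,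
    ExtGroup.toFreeProd_surjective, ExtGroup.ker_toFreeProd⟩, ?_⟩
  choose L hL using fun t => ExtGroup.exists_isCuspOrder hm hP (hindex t)
  refine ⟨L, fun t => (hL t).isIsolated (hindex t) hm, fun i j hij φ hφ => hij ?_⟩
  exact_mod_cast
    (hφ ▸ hL i).eq_of_autImage (hL j) i.cast_nonneg j.cast_nonneg hk hm hP hc
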